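/- Theorem. Consider the discrete-time system $$x_{t+1}=Ax_t+Bu_t+w_t,\qquad y_t=Cx_t+v_t,$$ with $x_t\in\mathbb R^n$, $u_t\in\mathbb R^m$, $y_t\in\mathbb R^p$, where $w_t\sim\mathcal N(0,W)$ and $v_t\sim\mathcal N(0,V)$, $t\ge 0$, are mutually independent, $W\succeq 0$, $V\succ 0$, and let $Q\succeq 0$, $R\succ 0$. Assume that $(A,B)$ and $(A,W^{1/2})$ are controllable and that $(C,A)$ and $(Q^{1/2},A)$ are observable. A full-order controller $\mathsf K=(A_{\mathsf K},B_{\mathsf K},C_{\mathsf K})\in\mathbb R^{n\times n}\times\mathbb R^{n\times p}\times\mathbb R^{m\times n}$ acts by $\xi_{t+1}=A_{\mathsf K}\xi_t+B_{\mathsf K}y_t$, $u_t=C_{\mathsf K}\xi_t$. Let $\mathcal C_n$ be the set of those $\mathsf K$ for which the closed-loop matrix $\begin{bmatrix}A&BC_{\mathsf K}\\ B_{\mathsf K}C&A_{\mathsf K}\end{bmatrix}$ has spectral radius less than $1$, and let $$J_n(\mathsf K)=\lim_{T\to\infty}\mathbb E\Big[\frac1T\sum_{t=1}^T\big(x_t^{\mathsf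 T}Qx_t+u_t^{\mathsf T}Ru_t\big)\Big],\qquad \mathsf K\in\mathcal C_n,$$ be the LQG cost, where the initial state $(x_0,\xi_0)$ is any square-integrable random vector independent of the noises. The controller $\mathsf K$ is called minimal if $(A_{\mathsf K},B_{\mathsf K})$ is controllable and $(C_{\mathsf K},A_{\mathsf K})$ is observable, and a stationary point if $\mathsf K\in\mathcal C_n$ and $J_n$ is differentiable at $\mathsf K$ with zero derivative with respect to $(A_{\mathsf K},B_{\mathsf K},C_{\mathsf K})$. Then the limit defining $J_n(\mathsf K)$ exists, with integrable stage costs, for every $\mathsf K\in\mathcal C_n$. The Riccati equations $$P=APA^{\mathsf T}-APC^{\mathsf T}(CPC^{\mathsf T}+V)^{-1}CPA^{\mathsf T}+W,\qquad S=A^{\mathsf T}SA-A^{\mathsf T}SB(B^{\mathsf T}SB+R)^{-1}B^{\mathsf T}SA+Q$$ each have a unique positive semidefinite solution, $P$ and $S$ respectively, and both are positive definite. Let $$K=(B^{\mathsf T}SB+R)^{-1}B^{\mathsf T}SA,\qquad L=APC^{\mathsf T}(CPC^{\mathsf T}+V)^{-1}.$$ Every minimal stationary point $\mathsf K\in\mathcal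 C_n$ of $J_n$ is globally optimal, that is, $J_n(\mathsf K)\le J_n(\mathsf K')$ for all $\mathsf K'\in\mathcal C_n$, and there is an invertible $T\in\mathbb R^{n\times n}$ such that $$A_{\mathsf K}=T(A-BK-LC)T^{-1},\qquad B_{\mathsf K}=-TL,\qquad C_{\mathsf K}=KT^{-1}.$$ -/

import Mathlib

open Matrix MeasureTheory ProbabilityTheory Filter Topology

/-- The data `(A, B, C, W, V, Q, R)` of a discrete-time LQG problem
`x_{t+1} = A x_t + B u_t + w_t`, `y_t = C x_t + v_t`, `w_t ∼ N(0, W)`, `v_t ∼ N(0, V)`, with stage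
cost `xᵀ Q x + uᵀ R u`, where `W, Q ⪰ 0` and `V, R ≻ 0`. -/
structure LQGSystem (n m p : ℕ) where
  A : Matrix (Fin n) (Fin n) ℝ
  B : Matrix (Fin n) (Fin m) ℝ
  C : Matrix (Fin p) (Fin n) ℝ
  W : Matrix (Fin n) (Fin n) ℝ
  V : Matrix (Fin p) (Fin p) ℝ
  Q : Matrix (Fin n) (Fin n) ℝ
  R : Matrix (Fin m) (Fin m) ℝ
  posSemidef_W : W.PosSemidef
  posDef_V : V.PosDef
  posSemidef_Q : Q.PosSemidef
  posDef_R : R.PosDef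

/-- The controllability matrix `[B, AB, …, A^{k-1}B]`. -/
def controllabilityMatrix {k l : ℕ} (A : Matrix (Fin k) (Fin k) ℝ) (B : Matrix (Fin k) (Fin l) ℝ) :
    Matrix (Fin k) (Fin k × Fin l) ℝ :=
  Matrix.of fun i j => (A ^ (j.1 : ℕ) * B) i j.2

/-- The observability matrix, with block rows `C, CA, …, CA^{k-1}`. -/
def observabilityMatrix {k l : ℕ} (C : Matrix (Fin l) (Fin k) ℝ) (A : Matrix (Fin k) (Fin k) ℝ) :
    Matrix (Fin k × Fin l) (Fin k) ℝ :=
  Matrix.of fun i j => (C * A ^ (i.1 : ℕ)) i.2 j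

/-- `(A, B)` is controllable. -/
def IsControllablePair {k l : ℕ} (A : Matrix (Fin k) (Fin k) ℝ)
    (B : Matrix (Fin k) (Fin l) ℝ) : Prop :=
  (controllabilityMatrix A B).rank = k

/-- `(C, A)` is observable. -/
def IsObservablePair {k l : ℕ} (C : Matrix (Fin l) (Fin k) ℝ)
    (A : Matrix (Fin k) (Fin k) ℝ) : Prop :=
  (observabilityMatrix C A).rank = k

section Sqrt

open scoped MatrixOrder Matrix.Norms.L2Operator

/-- The positive semidefinite square root `M^{1/2}` of a positive semidefinite matrix. -/
noncomputable def matrixSqrt {k : ℕ} (M : Matrix (Fin k) (Fin k) ℝ) : Matrix (Fin k) (Fin k) ℝ :=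
  CFC.sqrt M

/-- `matrixSqrt M` is positive semidefinite and squares to `M`, if `M` is positive semidefinite. -/
theorem matrixSqrt_spec {k : ℕ} {M : Matrix (Fin k) (Fin k) ℝ} (hM : M.PosSemidef) :
    (matrixSqrt M).PosSemidef ∧ matrixSqrt M * matrixSqrt M = M :=
  ⟨(CFC.sqrt_nonneg M).posSemidef, CFC.sqrt_mul_sqrt_self M hM.nonneg⟩

end Sqrt

/-- A strictly proper dynamical controller `ξ_{t+1} = A_K ξ_t + B_K y_t`, `u_t = C_K ξ_t` of
order `q`, i.e. the triple `(A_K, B_K, C_K)`, seen as a point of a finite-dimensional real vector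
space. -/
abbrev Controller (m p q : ℕ) : Type :=
  Matrix (Fin q) (Fin q) ℝ × Matrix (Fin q) (Fin p) ℝ × Matrix (Fin m) (Fin q) ℝ

namespace Controller

variable {m p q : ℕ}

/-- The matrix `A_K`. -/
abbrev AK (K : Controller m p q) : Matrix (Fin q) (Fin q) ℝ := K.1

/-- The matrix `B_K`. -/
abbrev BK (K : Controller m p q) : Matrix (Fin q) (Fin p) ℝ := K.2.1

/-- The matrix `C_K`. -/
abbrev CK (K : Controller m p q) : Matrix (Fin m) (Fin q) ℝ := K.2.2

/-- A controller is minimal if it is controllable and observable. -/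
def IsMinimal (K : Controller m p q) : Prop :=
  IsControllablePair K.AK K.BK ∧ IsObservablePair K.CK K.AK

end Controller

namespace LQGSystem

variable {n m p : ℕ}

/-- `(A, B)` and `(A, W^{1/2})` are controllable, `(C, A)` and `(Q^{1/2}, A)` are observable. -/
structure MinimalityAssumption (S : LQGSystem n m p) : Prop where
  controllable_B : IsControllablePair S.A S.B
  controllable_W : IsControllablePair S.A (matrixSqrt S.W)
  observable_C : IsObservablePair S.C S.A
  observable_Q : IsObservablePair (matrixSqrt S.Q) S.A

/-- The closed-loop matrix `[A, B C_K; B_K C, A_K]`. -/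
def closedLoop (S : LQGSystem n m p) {q : ℕ} (K : Controller m p q) :
    Matrix (Fin n ⊕ Fin q) (Fin n ⊕ Fin q) ℝ :=
  Matrix.fromBlocks S.A (S.B * K.CK) (K.BK * S.C) K.AK

/-- The set `𝒞_q` of stabilizing controllers of order `q`: those for which the (complex) spectral
radius of the closed-loop matrix is smaller than `1`. -/
def stabilizing (S : LQGSystem n m p) (q : ℕ) : Set (Controller m p q) :=
  {K | spectralRadius ℂ ((S.closedLoop K).map (algebraMap ℝ ℂ)) < 1}

/-- The random inputs of the closed loop with a controller of order `q`, on a probability space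
`(Ω, μ)`: an initial plant state `x0` and controller state `xi0` (arbitrary square-integrable random
vectors, possibly deterministic), the process noise `w` and the measurement noise `v`. The vectors
`w_t ∼ N(0, W)`, `v_t ∼ N(0, V)`, `t ∈ ℕ`, are mutually independent, and independent of the initial
state. -/
structure RandomInputs (S : LQGSystem n m p) (q : ℕ) {Ω : Type*} [MeasurableSpace Ω]
    (μ : Measure Ω) where
  x0 : Ω → Fin n → ℝ
  xi0 : Ω → Fin q → ℝ
  w : ℕ → Ω → EuclideanSpace ℝ (Fin n)
  v : ℕ → Ω → EuclideanSpace ℝ (Fin p)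
  measurable_x0 : Measurable x0
  measurable_xi0 : Measurable xi0
  measurable_w : ∀ t, Measurable (w t)
  measurable_v : ∀ t, Measurable (v t)
  memLp_x0 : MemLp x0 2 μ
  memLp_xi0 : MemLp xi0 2 μ
  law_w : ∀ t, HasLaw (w t) (multivariateGaussian 0 S.W) μ
  law_v : ∀ t, HasLaw (v t) (multivariateGaussian 0 S.V) μ
  indep_w_v : ∀ t, IndepFun (w t) (v t) μ
  indep_time : iIndepFun (fun t ω => (w t ω, v t ω)) μ
  indep_init : IndepFun (fun ω => (x0 ω, xi0 ω)) (fun ω t => (w t ω, v t ω)) μ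

section Cost

variable {q : ℕ} {Ω : Type*} [MeasurableSpace Ω] {μ : Measure Ω}

/-- The closed-loop trajectory `(x_t, ξ_t)` under the controller `K`. -/
def trajectory (S : LQGSystem n m p) (N : S.RandomInputs q μ) (K : Controller m p q) :
    ℕ → Ω → (Fin n → ℝ) × (Fin q → ℝ)
  | 0, ω => (N.x0 ω, N.xi0 ω)
  | t + 1, ω =>
    let x := (trajectory S N K t ω).1
    let ξ := (trajectory S N K t ω).2
    let u := K.CK *ᵥ ξ
    let y := S.C *ᵥ x + (N.v t ω).ofLp
    (S.A *ᵥ x + S.B *ᵥ u + (N.w t ω).ofLp, K.AK *ᵥ ξ + K.BK *ᵥ y)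

/-- The stage cost `x_tᵀ Q x_t + u_tᵀ R u_t`, with `u_t = C_K ξ_t`. -/
def stageCost (S : LQGSystem n m p) (N : S.RandomInputs q μ) (K : Controller m p q)
    (t : ℕ) (ω : Ω) : ℝ :=
  let x := (S.trajectory N K t ω).1
  let u := K.CK *ᵥ (S.trajectory N K t ω).2
  x ⬝ᵥ (S.Q *ᵥ x) + u ⬝ᵥ (S.R *ᵥ u)

/-- The expected average cost `𝔼[(1/T) ∑_{t=1}^T (x_tᵀ Q x_t + u_tᵀ R u_t)]`. -/
noncomputable def averageCost (S : LQGSystem n m p) (N : S.RandomInputs q μ)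
    (K : Controller m p q) (T : ℕ) : ℝ :=
  ∫ ω, (1 / (T : ℝ)) * ∑ t ∈ Finset.Icc 1 T, S.stageCost N K t ω ∂μ

/-- The LQG cost `J_q(K)`: the limit of the expected average cost as the horizon tends to `∞`. -/
noncomputable def cost (S : LQGSystem n m p) (N : S.RandomInputs q μ)
    (K : Controller m p q) : ℝ :=
  limUnder atTop (S.averageCost N K)

/-- `K` is a stationary point of `J_q` on `𝒞_q`: it is stabilizing and the derivative of
`J_q : 𝒞_q → ℝ` with respect to `(A_K, B_K, C_K)` exists and vanishes at `K`. -/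
def IsStationary (S : LQGSystem n m p) (N : S.RandomInputs q μ) (K : Controller m p q) : Prop :=
  K ∈ S.stabilizing q ∧
    HasFDerivWithinAt (S.cost N) (0 : Controller m p q →L[ℝ] ℝ) (S.stabilizing q) K

end Cost

/-- The filtering Riccati equation `P = A P Aᵀ - A P Cᵀ (C P Cᵀ + V)⁻¹ C P Aᵀ + W`. -/
def FilterRiccati (S : LQGSystem n m p) (P : Matrix (Fin n) (Fin n) ℝ) : Prop :=
  P = S.A * P * S.Aᵀ - S.A * P * S.Cᵀ * (S.C * P * S.Cᵀ + S.V)⁻¹ * S.C * P * S.Aᵀ + S.W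

/-- The control Riccati equation `Y = Aᵀ Y A - Aᵀ Y B (Bᵀ Y B + R)⁻¹ Bᵀ Y A + Q`. -/
def ControlRiccati (S : LQGSystem n m p) (Y : Matrix (Fin n) (Fin n) ℝ) : Prop :=
  Y = S.Aᵀ * Y * S.A - S.Aᵀ * Y * S.B * (S.Bᵀ * Y * S.B + S.R)⁻¹ * S.Bᵀ * Y * S.A + S.Q

/-- The feedback gain `K = (Bᵀ Y B + R)⁻¹ Bᵀ Y A`. -/
noncomputable def feedbackGain (S : LQGSystem n m p) (Y : Matrix (Fin n) (Fin n) ℝ) :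
    Matrix (Fin m) (Fin n) ℝ :=
  (S.Bᵀ * Y * S.B + S.R)⁻¹ * S.Bᵀ * Y * S.A

/-- The Kalman gain `L = A P Cᵀ (C P Cᵀ + V)⁻¹`. -/
noncomputable def kalmanGain (S : LQGSystem n m p) (P : Matrix (Fin n) (Fin n) ℝ) :
    Matrix (Fin n) (Fin p) ℝ :=
  S.A * P * S.Cᵀ * (S.C * P * S.Cᵀ + S.V)⁻¹

end LQGSystem

/-! For stabilizing 𝖪 with closed-loop matrix F, the state covariance converges to the solution X of
X = F X Fᵀ + diag(W, B_K V B_Kᵀ), and J(𝖪) = tr(diag(Q, C_Kᵀ R C_K) X) (`tendsto_averageCost`). Let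
Z solve the dual equation Z = Fᵀ Z F + diag(Q, C_Kᵀ R C_K). Stationarity is then three equations in
the blocks of X Fᵀ Z (`IsStationary.gradient_eq_zero`).

Minimality makes X₂₂ and Z₂₂ positive definite, so both Gramians split off Schur complements: X =
diag(P, 0) + [H; 1] X₂₂ [Hᵀ, 1] and Z = diag(Y, 0) + [-Γᵀ; 1] Z₂₂ [-Γ, 1]. In these coordinates
stationarity reads A_K + B_K C H = Γ(A H + B C_K), B_K = Γ L, C_K = -K H, where L and K are the
gains built from P and Y (`stationarity_schur`). Substituted in the Lyapunov equation of X, this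
gives Γ H = 1 and, H and Γ being square, the filtering Riccati equation for P
(`filterRiccati_of_schur`); dually Y solves the control Riccati equation. Uniqueness of the positive
semidefinite solutions identifies P and Y, and T = -Γ is the required similarity.

Global optimality comes from completing squares with the two Riccati solutions. With Θ = [K, C_K],
any stabilizing controller has cost tr(Y W) + tr((Bᵀ Y B + R) Θ X Θᵀ), and X ⪰ diag(P, 0), which
gives a lower bound independent of the controller (`le_cost`). At the stationary point Θ [H; 1] = 0,
so the bound is attained (`cost_eq_of_gain`).

The Riccati equations are treated once, for control: value iteration from 0 is monotone and, by
controllability, bounded; observability makes the limit positive definite and stabilizing, hence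
unique. The filtering equation follows by duality. -/

/-! ### Schur stability and the spectral radius -/

namespace Matrix

variable {ι κ : Type*} [Fintype ι] [DecidableEq ι]

/-- A real square matrix is (Schur) stable if its powers tend to zero. -/
def IsStable (F : Matrix ι ι ℝ) : Prop :=
  Tendsto (fun k : ℕ => F ^ k) atTop (𝓝 0)

theorem IsStable.transpose {F : Matrix ι ι ℝ} (hF : F.IsStable) : Fᵀ.IsStable := by
  have h : Tendsto (fun k : ℕ => (F ^ k)ᵀ) atTop (𝓝 (0 : Matrix ι ι ℝ)ᵀ) :=
    (continuous_id.matrix_transpose.tendsto _).comp hF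
  simpa [IsStable, transpose_pow] using h

section Norm

open scoped Matrix.Norms.Operator

theorem isStable_iff_map_complex {F : Matrix ι ι ℝ} :
    F.IsStable ↔ Tendsto (fun k : ℕ => (F.map (algebraMap ℝ ℂ)) ^ k) atTop (𝓝 0) := by
  have hpow : ∀ k : ℕ, (F.map (algebraMap ℝ ℂ)) ^ k = (F ^ k).map (algebraMap ℝ ℂ) := fun k =>
    (Matrix.map_pow F (algebraMap ℝ ℂ) k).symm
  simp only [hpow]
  constructor
  · intro h
    have := ((continuous_id.matrix_map (f := algebraMap ℝ ℂ) (by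
      exact Complex.continuous_ofReal)).tendsto (0 : Matrix ι ι ℝ)).comp h
    simpa [Function.comp_def] using this
  · intro h
    have := ((continuous_id.matrix_map (f := Complex.re)
      Complex.continuous_re).tendsto (0 : Matrix ι ι ℂ)).comp h
    have h0 : (id (0 : Matrix ι ι ℂ)).map Complex.re = 0 := by ext; simp
    rw [h0] at this
    refine this.congr fun k => ?_
    ext i j
    simp

/-- By Gelfand's formula ‖aᵏ‖^(1/k) is eventually below some r < 1, so ‖aᵏ‖ ≤ rᵏ. -/
theorem tendsto_pow_zero_of_spectralRadius_lt_one {A : Type*} [NormedRing A] [NormedAlgebra ℂ A]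
    [CompleteSpace A] {a : A} (h : spectralRadius ℂ a < 1) :
    Tendsto (fun k : ℕ => a ^ k) atTop (𝓝 0) := by
  obtain ⟨r, hr, hr1⟩ := ENNReal.lt_iff_exists_nnreal_btwn.1 h
  have hr1' : r < 1 := by exact_mod_cast hr1
  have hev := (spectrum.pow_nnnorm_pow_one_div_tendsto_nhds_spectralRadius a).eventually
    (eventually_lt_nhds hr)
  rw [tendsto_zero_iff_norm_tendsto_zero]
  refine squeeze_zero' (Eventually.of_forall fun k => norm_nonneg _) ?_
    (tendsto_pow_atTop_nhds_zero_of_lt_one r.2 hr1')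
  filter_upwards [hev, eventually_ge_atTop 1] with k hk hk1
  have hk0 : (0 : ℝ) < k := by exact_mod_cast hk1
  have h1 : (‖a ^ k‖₊ : ENNReal) ≤ (r : ENNReal) ^ k := by
    have := ENNReal.rpow_le_rpow hk.le hk0.le
    rwa [← ENNReal.rpow_mul, one_div, inv_mul_cancel₀ hk0.ne', ENNReal.rpow_one,
      ENNReal.rpow_natCast] at this
  have h2 : ‖a ^ k‖₊ ≤ r ^ k := by exact_mod_cast h1
  exact_mod_cast h2

theorem spectralRadius_lt_one_of_nnnorm_pow_lt_one {A : Type*} [NormedRing A] [NormedAlgebra ℂ A]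
    [CompleteSpace A] [NormOneClass A] {a : A} {k : ℕ} (hk : k ≠ 0) (h : ‖a ^ k‖₊ < 1) :
    spectralRadius ℂ a < 1 := by
  by_contra! hge
  have h1 : (1 : ENNReal) ≤ spectralRadius ℂ a ^ k := one_le_pow₀ hge
  have h2 := h1.trans ((spectrum.spectralRadius_pow_le a k hk).trans
    (spectrum.spectralRadius_le_nnnorm (a ^ k)))
  exact absurd h (not_lt.2 (by exact_mod_cast h2))

theorem spectralRadius_map_lt_one_of_nnnorm_pow_lt_one {F : Matrix ι ι ℝ} {k : ℕ} (hk : k ≠ 0)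
    (h : ‖(F.map (algebraMap ℝ ℂ)) ^ k‖₊ < 1) :
    spectralRadius ℂ (F.map (algebraMap ℝ ℂ)) < 1 := by
  -- Over an empty index type the identity has norm 0, so `NormOneClass` is available only in the
  -- nonempty case.
  cases isEmpty_or_nonempty ι
  · simp [spectralRadius, spectrum.of_subsingleton]
  · exact spectralRadius_lt_one_of_nnnorm_pow_lt_one hk h

theorem isStable_iff_spectralRadius_lt_one {F : Matrix ι ι ℝ} :
    F.IsStable ↔ spectralRadius ℂ (F.map (algebraMap ℝ ℂ)) < 1 := by
  rw [isStable_iff_map_complex]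
  refine ⟨fun h => ?_, fun h => tendsto_pow_zero_of_spectralRadius_lt_one h⟩
  have h1 := (tendsto_zero_iff_norm_tendsto_zero.1 h).eventually (eventually_lt_nhds one_pos)
  obtain ⟨k, hk, hk1⟩ := (h1.and (eventually_ne_atTop 0)).exists
  exact spectralRadius_map_lt_one_of_nnnorm_pow_lt_one hk1 (by exact_mod_cast hk)

/-- Stability is witnessed by a single power of norm less than 1, which is an open condition. -/
theorem isOpen_setOf_isStable : IsOpen {F : Matrix ι ι ℝ | F.IsStable} := by
  rw [isOpen_iff_mem_nhds]
  intro F hF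
  have h1 := (tendsto_zero_iff_norm_tendsto_zero.1 (isStable_iff_map_complex.1 hF)).eventually
    (eventually_lt_nhds one_pos)
  obtain ⟨k, hk, hk1⟩ := (h1.and (eventually_ne_atTop 0)).exists
  have hc : Continuous fun G : Matrix ι ι ℝ => ‖(G.map (algebraMap ℝ ℂ)) ^ k‖ :=
    ((continuous_id.matrix_map (f := algebraMap ℝ ℂ) (by
      exact Complex.continuous_ofReal)).pow k).norm
  filter_upwards [hc.tendsto F |>.eventually (eventually_lt_nhds hk)] with G hG
  exact isStable_iff_spectralRadius_lt_one.2
    (spectralRadius_map_lt_one_of_nnnorm_pow_lt_one hk1 (by exact_mod_cast hG))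

end Norm

end Matrix

/-! ### Discrete Lyapunov equations -/

namespace Matrix

variable {ι κ : Type*}

theorem PosSemidef.transpose_eq {M : Matrix ι ι ℝ} (hM : M.PosSemidef) : Mᵀ = M := by
  simpa [IsHermitian] using hM.1

theorem PosDef.transpose_eq {M : Matrix ι ι ℝ} (hM : M.PosDef) : Mᵀ = M :=
  hM.posSemidef.transpose_eq

variable [Fintype ι] [Fintype κ]

theorem posSemidef_of_dotProduct_mulVec_nonneg {M : Matrix ι ι ℝ} (hM : Mᵀ = M)
    (h : ∀ x, 0 ≤ x ⬝ᵥ (M *ᵥ x)) : M.PosSemidef :=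
  .of_dotProduct_mulVec_nonneg (by simpa [IsHermitian] using hM) (by simpa using h)

theorem PosSemidef.dotProduct_nonneg {M : Matrix ι ι ℝ} (hM : M.PosSemidef) (x : ι → ℝ) :
    0 ≤ x ⬝ᵥ (M *ᵥ x) := by
  simpa using hM.dotProduct_mulVec_nonneg x

theorem PosSemidef.mul_mul_transpose {M : Matrix ι ι ℝ} (hM : M.PosSemidef) (B : Matrix κ ι ℝ) :
    (B * M * Bᵀ).PosSemidef := by
  simpa using hM.mul_mul_conjTranspose_same B

theorem PosSemidef.transpose_mul_mul {M : Matrix ι ι ℝ} (hM : M.PosSemidef) (B : Matrix ι κ ℝ) :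
    (Bᵀ * M * B).PosSemidef := by
  simpa using hM.conjTranspose_mul_mul_same B

variable [DecidableEq ι] [DecidableEq κ]

theorem eq_pow_mul_mul_pow {F : Matrix ι ι ℝ} {G : Matrix κ κ ℝ} {D : Matrix ι κ ℝ}
    (h : D = F * D * G) (k : ℕ) : D = F ^ k * D * G ^ k := by
  induction k with
  | zero => simp
  | succ k ih =>
    calc D = F * D * G := h
      _ = F * (F ^ k * D * G ^ k) * G := by rw [← ih]
      _ = F ^ (k + 1) * D * G ^ (k + 1) := by
        rw [pow_succ', pow_succ]; simp only [Matrix.mul_assoc]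

/-- Iterating gives D = Fᵏ D Gᵏ, which tends to 0. Two different stable factors are allowed because
the uniqueness proof for the Riccati equation needs them. -/
theorem IsStable.eq_zero_of_eq_mul_mul {F : Matrix ι ι ℝ} {G : Matrix κ κ ℝ} (hF : F.IsStable)
    (hG : G.IsStable) {D : Matrix ι κ ℝ} (h : D = F * D * G) : D = 0 := by
  have hc : Continuous fun p : Matrix ι ι ℝ × Matrix κ κ ℝ => p.1 * D * p.2 :=
    (continuous_fst.matrix_mul continuous_const).matrix_mul continuous_snd
  have h1 := (hc.tendsto (0, 0)).comp (Tendsto.prodMk_nhds hF hG)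
  simp only [Function.comp_def, Matrix.zero_mul, ← eq_pow_mul_mul_pow h] at h1
  exact tendsto_nhds_unique tendsto_const_nhds h1

theorem IsStable.lyapunov_unique {F W X X' : Matrix ι ι ℝ} (hF : F.IsStable)
    (hX : X = F * X * Fᵀ + W) (hX' : X' = F * X' * Fᵀ + W) : X = X' := by
  refine sub_eq_zero.1 (hF.eq_zero_of_eq_mul_mul hF.transpose ?_)
  calc X - X' = (F * X * Fᵀ + W) - (F * X' * Fᵀ + W) := by rw [← hX, ← hX']
    _ = _ := by noncomm_ring

section Norm

open scoped Matrix.Norms.Operator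

theorem IsStable.isUnit_one_sub_mulLeftRight {F : Matrix ι ι ℝ} (hF : F.IsStable) :
    IsUnit (1 - ContinuousLinearMap.mulLeftRight ℝ (Matrix ι ι ℝ) F Fᵀ) := by
  rw [ContinuousLinearMap.isUnit_iff_bijective]
  have hinj : Function.Injective
      (1 - ContinuousLinearMap.mulLeftRight ℝ (Matrix ι ι ℝ) F Fᵀ).toLinearMap := by
    rw [← LinearMap.ker_eq_bot, LinearMap.ker_eq_bot']
    intro D hD
    refine hF.eq_zero_of_eq_mul_mul hF.transpose ?_
    simpa [sub_eq_zero] using hD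
  exact ⟨hinj, LinearMap.injective_iff_surjective.1 hinj⟩

theorem IsStable.exists_lyapunov {F : Matrix ι ι ℝ} (hF : F.IsStable) (W : Matrix ι ι ℝ) :
    ∃ X, X = F * X * Fᵀ + W := by
  obtain ⟨X, hX⟩ := (ContinuousLinearMap.isUnit_iff_bijective.1
    hF.isUnit_one_sub_mulLeftRight).2 W
  refine ⟨X, ?_⟩
  rw [← hX]
  simp

/-- Near F the solution is the inverse of the operator 1 - F · Fᵀ applied to W, and inversion is
continuous at units. This is all the regularity of the covariance that the gradient computation
uses. -/
theorem IsStable.tendsto_lyapunov {F W X : Matrix ι ι ℝ} (hF : F.IsStable)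
    (hX : X = F * X * Fᵀ + W) {α : Type*} {l : Filter α} {F' W' X' : α → Matrix ι ι ℝ}
    (hF' : Tendsto F' l (𝓝 F)) (hW' : Tendsto W' l (𝓝 W))
    (hX' : ∀ᶠ a in l, X' a = F' a * X' a * (F' a)ᵀ + W' a) : Tendsto X' l (𝓝 X) := by
  let T := fun G : Matrix ι ι ℝ =>
    1 - ContinuousLinearMap.mulLeftRight ℝ (Matrix ι ι ℝ) G Gᵀ
  have hT : Continuous T := by
    have h2 : Continuous fun G : Matrix ι ι ℝ => Gᵀ := continuous_id.matrix_transpose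
    exact continuous_const.sub
      (((ContinuousLinearMap.mulLeftRight ℝ (Matrix ι ι ℝ)).continuous).clm_apply h2)
  have hsol : ∀ {G V Z : Matrix ι ι ℝ}, IsUnit (T G) → Z = G * Z * Gᵀ + V →
      Z = Ring.inverse (T G) V := by
    intro G V Z hG hZ
    have h1 : T G Z = V := by
      have : T G Z = Z - G * Z * Gᵀ := by simp [T]
      rw [this]
      nth_rewrite 1 [hZ]
      abel
    rw [← h1, ← mul_apply_eq_comp, Ring.inverse_mul_cancel _ hG]
    rfl
  have hU : IsUnit (T F) := hF.isUnit_one_sub_mulLeftRight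
  have hTl : Tendsto (fun a => T (F' a)) l (𝓝 (T F)) := (hT.tendsto F).comp hF'
  have hUev : ∀ᶠ a in l, IsUnit (T (F' a)) := hTl.eventually (Units.isOpen.mem_nhds hU)
  have hinv : Tendsto (fun a => Ring.inverse (T (F' a))) l (𝓝 (Ring.inverse (T F))) := by
    obtain ⟨u, hu⟩ := hU
    have h := NormedRing.inverse_continuousAt u
    rw [hu] at h
    exact h.tendsto.comp hTl
  rw [hsol hU hX]
  refine ((isBoundedBilinearMap_apply.continuous.tendsto _).comp
    (hinv.prodMk_nhds hW')).congr' ?_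
  filter_upwards [hUev, hX'] with a ha hXa
  exact (hsol ha hXa).symm

end Norm

theorem IsStable.lyapunov_transpose {F W X : Matrix ι ι ℝ} (hF : F.IsStable)
    (hW : Wᵀ = W) (hX : X = F * X * Fᵀ + W) : Xᵀ = X := by
  refine hF.lyapunov_unique (W := W) ?_ hX
  conv_lhs => rw [hX]
  simp [Matrix.mul_assoc, hW]

/-- X - Fᵏ X (Fᵏ)ᵀ is the partial sum of Fⁱ W (Fⁱ)ᵀ over i < k, hence positive semidefinite; let k
tend to infinity. -/
theorem IsStable.posSemidef_lyapunov {F W X : Matrix ι ι ℝ} (hF : F.IsStable)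
    (hW : W.PosSemidef) (hX : X = F * X * Fᵀ + W) : X.PosSemidef := by
  have hXt := hF.lyapunov_transpose hW.transpose_eq hX
  refine posSemidef_of_dotProduct_mulVec_nonneg hXt fun x => ?_
  have hk : ∀ k : ℕ, (X - F ^ k * X * (F ^ k)ᵀ).PosSemidef := by
    intro k
    induction k with
    | zero => simpa using PosSemidef.zero
    | succ k ih =>
      have h1 : X - F ^ (k + 1) * X * (F ^ (k + 1))ᵀ =
          F * (X - F ^ k * X * (F ^ k)ᵀ) * Fᵀ + W := by
        calc X - F ^ (k + 1) * X * (F ^ (k + 1))ᵀ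
            = (F * X * Fᵀ + W) - F ^ (k + 1) * X * (F ^ (k + 1))ᵀ := by rw [← hX]
          _ = _ := by
            rw [pow_succ', transpose_mul]
            noncomm_ring
      rw [h1]
      exact (ih.mul_mul_transpose F).add hW
  have hlim : Tendsto (fun k : ℕ => x ⬝ᵥ ((X - F ^ k * X * (F ^ k)ᵀ) *ᵥ x)) atTop
      (𝓝 (x ⬝ᵥ ((X - 0 * X * 0ᵀ) *ᵥ x))) := by
    have hc : Continuous fun G : Matrix ι ι ℝ => x ⬝ᵥ ((X - G * X * Gᵀ) *ᵥ x) := by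
      fun_prop
    exact (hc.tendsto 0).comp hF
  have := ge_of_tendsto' hlim fun k => (hk k).dotProduct_nonneg x
  simpa using this

end Matrix

/-! ### Second moments of linear recursions -/

section CrossMoment

variable {ι κ l : Type*} {Ω : Type*} [MeasurableSpace Ω] {μ : Measure Ω}

/-- The matrix `𝔼[X Yᵀ]` of second moments of two random vectors. -/
noncomputable def crossMoment (μ : Measure Ω) (X : Ω → ι → ℝ) (Y : Ω → κ → ℝ) : Matrix ι κ ℝ :=
  Matrix.of fun i j => ∫ ω, X ω i * Y ω j ∂μ

theorem crossMoment_transpose (X : Ω → ι → ℝ) (Y : Ω → κ → ℝ) :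
    (crossMoment μ X Y)ᵀ = crossMoment μ Y X := by
  ext i j
  simp [crossMoment, mul_comm]

variable [Fintype ι] [Fintype κ]

theorem memLp_mulVec {X : Ω → ι → ℝ} (hX : MemLp X 2 μ) (F : Matrix κ ι ℝ) :
    MemLp (fun ω => F *ᵥ X ω) 2 μ := by
  rw [memLp_pi_iff]
  intro i
  simp only [mulVec, dotProduct]
  exact memLp_finsetSum _ fun j _ => (hX.eval j).const_mul _

theorem integrable_apply_mul_apply {X : Ω → ι → ℝ} {Y : Ω → κ → ℝ} (hX : MemLp X 2 μ)
    (hY : MemLp Y 2 μ) (i : ι) (j : κ) : Integrable (fun ω => X ω i * Y ω j) μ :=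
  (hX.eval i).integrable_mul (hY.eval j)

theorem crossMoment_mulVec_left {X : Ω → ι → ℝ} {Y : Ω → κ → ℝ} (hX : MemLp X 2 μ)
    (hY : MemLp Y 2 μ) (F : Matrix l ι ℝ) :
    crossMoment μ (fun ω => F *ᵥ X ω) Y = F * crossMoment μ X Y := by
  ext i j
  simp only [crossMoment, of_apply, mulVec, dotProduct, Matrix.mul_apply, Finset.sum_mul,
    mul_assoc]
  rw [integral_finsetSum _ fun a _ => (integrable_apply_mul_apply hX hY a j).const_mul _]
  simp only [integral_const_mul]

theorem crossMoment_mulVec_right {X : Ω → ι → ℝ} {Y : Ω → κ → ℝ} (hX : MemLp X 2 μ)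
    (hY : MemLp Y 2 μ) (F : Matrix l κ ℝ) :
    crossMoment μ X (fun ω => F *ᵥ Y ω) = crossMoment μ X Y * Fᵀ := by
  rw [← crossMoment_transpose, crossMoment_mulVec_left hY hX, transpose_mul,
    crossMoment_transpose]

theorem crossMoment_add_left {X X' : Ω → ι → ℝ} {Y : Ω → κ → ℝ} (hX : MemLp X 2 μ)
    (hX' : MemLp X' 2 μ) (hY : MemLp Y 2 μ) :
    crossMoment μ (fun ω => X ω + X' ω) Y = crossMoment μ X Y + crossMoment μ X' Y := by
  ext i j
  simp only [crossMoment, of_apply, Pi.add_apply, add_mul, Matrix.add_apply]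
  exact integral_add (integrable_apply_mul_apply hX hY i j)
    (integrable_apply_mul_apply hX' hY i j)

theorem crossMoment_add_right {X : Ω → ι → ℝ} {Y Y' : Ω → κ → ℝ} (hX : MemLp X 2 μ)
    (hY : MemLp Y 2 μ) (hY' : MemLp Y' 2 μ) :
    crossMoment μ X (fun ω => Y ω + Y' ω) = crossMoment μ X Y + crossMoment μ X Y' := by
  rw [← crossMoment_transpose, crossMoment_add_left hY hY' hX, transpose_add,
    crossMoment_transpose, crossMoment_transpose]

theorem dotProduct_mulVec_eq_sum (M : Matrix ι ι ℝ) (x : ι → ℝ) :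
    x ⬝ᵥ (M *ᵥ x) = ∑ i, ∑ j, M i j * (x j * x i) := by
  simp only [dotProduct, mulVec, Finset.mul_sum]
  exact Finset.sum_congr rfl fun i _ => Finset.sum_congr rfl fun j _ => by ring

theorem integrable_dotProduct_mulVec {X : Ω → ι → ℝ} (hX : MemLp X 2 μ) (M : Matrix ι ι ℝ) :
    Integrable (fun ω => X ω ⬝ᵥ (M *ᵥ X ω)) μ := by
  simp only [dotProduct_mulVec_eq_sum]
  exact integrable_finsetSum _ fun i _ => integrable_finsetSum _ fun j _ =>
    (integrable_apply_mul_apply hX hX j i).const_mul _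

theorem integral_dotProduct_mulVec {X : Ω → ι → ℝ} (hX : MemLp X 2 μ) (M : Matrix ι ι ℝ) :
    ∫ ω, X ω ⬝ᵥ (M *ᵥ X ω) ∂μ = (M * crossMoment μ X X).trace := by
  have hint : ∀ i j, Integrable (fun ω => M i j * (X ω j * X ω i)) μ := fun i j =>
    (integrable_apply_mul_apply hX hX j i).const_mul _
  simp only [dotProduct_mulVec_eq_sum]
  rw [integral_finsetSum _ fun i _ => integrable_finsetSum _ fun j _ => hint i j]
  simp only [trace, diag_apply, Matrix.mul_apply, crossMoment, of_apply]
  refine Finset.sum_congr rfl fun i _ => ?_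
  rw [integral_finsetSum _ fun j _ => hint i j]
  simp only [integral_const_mul]

/-- A linear recursion `Z_{t+1} = F Z_t + G e_t` driven by square-integrable noise `e` which is
uncorrelated with the initial state, and white with covariance `M`. -/
structure IsLinearRecursion (μ : Measure Ω) (F : Matrix ι ι ℝ) (G : Matrix ι κ ℝ)
    (M : Matrix κ κ ℝ) (Z : ℕ → Ω → ι → ℝ) (e : ℕ → Ω → κ → ℝ) : Prop where
  step : ∀ t ω, Z (t + 1) ω = F *ᵥ Z t ω + G *ᵥ e t ω
  memLp_init : MemLp (Z 0) 2 μ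
  memLp_noise : ∀ t, MemLp (e t) 2 μ
  init_noise : ∀ t, crossMoment μ (Z 0) (e t) = 0
  noise_noise : ∀ s t, s ≠ t → crossMoment μ (e s) (e t) = 0
  noise_cov : ∀ t, crossMoment μ (e t) (e t) = M

namespace IsLinearRecursion

variable {F : Matrix ι ι ℝ} {G : Matrix ι κ ℝ} {M : Matrix κ κ ℝ} {Z : ℕ → Ω → ι → ℝ}
  {e : ℕ → Ω → κ → ℝ}

theorem memLp (h : IsLinearRecursion μ F G M Z e) (t : ℕ) : MemLp (Z t) 2 μ := by
  induction t with
  | zero => exact h.memLp_init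
  | succ t ih =>
    rw [funext (h.step t)]
    exact (memLp_mulVec ih F).add (memLp_mulVec (h.memLp_noise t) G)

theorem crossMoment_noise (h : IsLinearRecursion μ F G M Z e) (t : ℕ) :
    ∀ s, t ≤ s → crossMoment μ (Z t) (e s) = 0 := by
  induction t with
  | zero => exact fun s _ => h.init_noise s
  | succ t ih =>
    intro s hs
    rw [funext (h.step t), crossMoment_add_left (memLp_mulVec (h.memLp t) F)
      (memLp_mulVec (h.memLp_noise t) G) (h.memLp_noise s),
      crossMoment_mulVec_left (h.memLp t) (h.memLp_noise s),
      crossMoment_mulVec_left (h.memLp_noise t) (h.memLp_noise s), ih s (by omega),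
      h.noise_noise t s (by omega)]
    simp

theorem crossMoment_succ (h : IsLinearRecursion μ F G M Z e) (t : ℕ) :
    crossMoment μ (Z (t + 1)) (Z (t + 1)) =
      F * crossMoment μ (Z t) (Z t) * Fᵀ + G * M * Gᵀ := by
  have hZ := h.memLp t
  have he := h.memLp_noise t
  have hFZ := memLp_mulVec hZ F
  have hGe := memLp_mulVec he G
  have hsum : MemLp (fun ω => F *ᵥ Z t ω + G *ᵥ e t ω) 2 μ := hFZ.add hGe
  have h1 := h.crossMoment_noise t t le_rfl
  have h2 : crossMoment μ (e t) (Z t) = 0 := by rw [← crossMoment_transpose, h1, transpose_zero]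
  rw [funext (h.step t), crossMoment_add_left hFZ hGe hsum,
    crossMoment_add_right hFZ hFZ hGe, crossMoment_add_right hGe hFZ hGe,
    crossMoment_mulVec_left hZ hFZ, crossMoment_mulVec_left hZ hGe,
    crossMoment_mulVec_left he hFZ, crossMoment_mulVec_left he hGe,
    crossMoment_mulVec_right hZ hZ, crossMoment_mulVec_right hZ he,
    crossMoment_mulVec_right he hZ, crossMoment_mulVec_right he he, h1, h2, h.noise_cov]
  simp [Matrix.mul_assoc]

/-- The deviation of the covariance from X is propagated by D ↦ F D Fᵀ, so the initial state is
forgotten. -/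
theorem tendsto_crossMoment [DecidableEq ι] (h : IsLinearRecursion μ F G M Z e)
    (hF : F.IsStable) {X : Matrix ι ι ℝ} (hX : X = F * X * Fᵀ + G * M * Gᵀ) :
    Tendsto (fun t => crossMoment μ (Z t) (Z t)) atTop (𝓝 X) := by
  have hpow : ∀ t : ℕ, crossMoment μ (Z t) (Z t) =
      F ^ t * (crossMoment μ (Z 0) (Z 0) - X) * (F ^ t)ᵀ + X := by
    intro t
    induction t with
    | zero => simp
    | succ t ih =>
      calc crossMoment μ (Z (t + 1)) (Z (t + 1))
          = F * (F ^ t * (crossMoment μ (Z 0) (Z 0) - X) * (F ^ t)ᵀ + X) * Fᵀ + G * M * Gᵀ := by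
            rw [h.crossMoment_succ, ih]
        _ = F ^ (t + 1) * (crossMoment μ (Z 0) (Z 0) - X) * (F ^ (t + 1))ᵀ +
            (F * X * Fᵀ + G * M * Gᵀ) := by
            rw [pow_succ', transpose_mul]
            noncomm_ring
        _ = _ := by rw [← hX]
  have hc : Continuous fun P : Matrix ι ι ℝ =>
      P * (crossMoment μ (Z 0) (Z 0) - X) * Pᵀ + X := by fun_prop
  have h0 := (hc.tendsto 0).comp hF
  simp only [Function.comp_def, ← hpow, Matrix.zero_mul, zero_add] at h0
  exact h0

theorem tendsto_average [DecidableEq ι] (h : IsLinearRecursion μ F G M Z e) (hF : F.IsStable)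
    {X : Matrix ι ι ℝ} (hX : X = F * X * Fᵀ + G * M * Gᵀ) (N : Matrix ι ι ℝ) :
    Tendsto (fun T : ℕ =>
      ∫ ω, (1 / (T : ℝ)) * ∑ t ∈ Finset.Icc 1 T, Z t ω ⬝ᵥ (N *ᵥ Z t ω) ∂μ) atTop
      (𝓝 (N * X).trace) := by
  have hc : Continuous fun P : Matrix ι ι ℝ => (N * P).trace := by fun_prop
  have h1 : Tendsto (fun t : ℕ => (N * crossMoment μ (Z t) (Z t)).trace) atTop
      (𝓝 (N * X).trace) := (hc.tendsto X).comp (h.tendsto_crossMoment hF hX)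
  -- The average runs over t = 1, …, T, so the Cesàro theorem is applied to the sequence shifted by
  -- one.
  refine ((tendsto_add_atTop_iff_nat 1).2 h1).cesaro.congr fun T => ?_
  rw [integral_const_mul, integral_finsetSum _ fun t _ => integrable_dotProduct_mulVec
    (h.memLp t) N, one_div]
  simp only [integral_dotProduct_mulVec (h.memLp _)]
  rw [Finset.range_eq_Ico, Finset.sum_Ico_add' (fun t =>
    (N * crossMoment μ (Z t) (Z t)).trace) 0 T 1]
  rfl

end IsLinearRecursion

end CrossMoment

/-! ### The LQG cost as a trace -/

namespace LQGSystem

variable {n m p q : ℕ}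

/-- The matrix through which the stacked noise `(w_t, v_t)` enters the closed loop. -/
def noiseInput (_S : LQGSystem n m p) (K : Controller m p q) :
    Matrix (Fin n ⊕ Fin q) (Fin n ⊕ Fin p) ℝ :=
  fromBlocks 1 0 0 K.BK

/-- The covariance `diag(W, V)` of the stacked noise. -/
def noiseCov (S : LQGSystem n m p) : Matrix (Fin n ⊕ Fin p) (Fin n ⊕ Fin p) ℝ :=
  fromBlocks S.W 0 0 S.V

/-- The covariance `diag(W, B_K V B_Kᵀ)` of the closed-loop noise. -/
def closedLoopNoise (S : LQGSystem n m p) (K : Controller m p q) :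
    Matrix (Fin n ⊕ Fin q) (Fin n ⊕ Fin q) ℝ :=
  fromBlocks S.W 0 0 (K.BK * S.V * K.BKᵀ)

/-- The weight `diag(Q, C_Kᵀ R C_K)` of the closed-loop cost. -/
def closedLoopWeight (S : LQGSystem n m p) (K : Controller m p q) :
    Matrix (Fin n ⊕ Fin q) (Fin n ⊕ Fin q) ℝ :=
  fromBlocks S.Q 0 0 (K.CKᵀ * S.R * K.CK)

theorem noiseInput_mul_noiseCov (S : LQGSystem n m p) (K : Controller m p q) :
    S.noiseInput K * S.noiseCov * (S.noiseInput K)ᵀ = S.closedLoopNoise K := by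
  simp [noiseInput, noiseCov, closedLoopNoise, fromBlocks_multiply, fromBlocks_transpose]

theorem mem_stabilizing_iff {S : LQGSystem n m p} {K : Controller m p q} :
    K ∈ S.stabilizing q ↔ (S.closedLoop K).IsStable :=
  isStable_iff_spectralRadius_lt_one.symm

section Cost

variable {Ω : Type*} [MeasurableSpace Ω] {μ : Measure Ω} {S : LQGSystem n m p}

namespace RandomInputs

/-- The stacked noise `(w_t, v_t)`. -/
def noise (N : S.RandomInputs q μ) (t : ℕ) (ω : Ω) : Fin n ⊕ Fin p → ℝ :=
  Sum.elim (N.w t ω) (N.v t ω)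

theorem memLp_of_hasLaw_gaussian {k : ℕ} {M : Matrix (Fin k) (Fin k) ℝ}
    {X : Ω → EuclideanSpace ℝ (Fin k)} (hX : HasLaw X (multivariateGaussian 0 M) μ) (i : Fin k) :
    MemLp (fun ω => X ω i) 2 μ := by
  have h1 : MemLp (id : EuclideanSpace ℝ (Fin k) → _) 2 (μ.map X) := by
    rw [hX.map_eq]; exact IsGaussian.memLp_two_id
  exact (h1.comp_of_map hX.aemeasurable).eval_piLp i

theorem integral_of_hasLaw_gaussian {k : ℕ} {M : Matrix (Fin k) (Fin k) ℝ}
    {X : Ω → EuclideanSpace ℝ (Fin k)} (hX : HasLaw X (multivariateGaussian 0 M) μ) (i : Fin k) :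
    ∫ ω, X ω i ∂μ = 0 := by
  have h1 := hX.integral_comp (f := fun x : EuclideanSpace ℝ (Fin k) => x i)
    (by fun_prop)
  have h2 := (EuclideanSpace.proj (𝕜 := ℝ) i).integral_comp_comm
    (IsGaussian.integrable_id (μ := multivariateGaussian (0 : EuclideanSpace ℝ (Fin k)) M))
  simp only [id, integral_id_multivariateGaussian] at h2
  simpa [Function.comp_def] using h1.trans h2

theorem integral_mul_of_hasLaw_gaussian [IsProbabilityMeasure μ] {k : ℕ}
    {M : Matrix (Fin k) (Fin k) ℝ} (hM : M.PosSemidef)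
    {X : Ω → EuclideanSpace ℝ (Fin k)} (hX : HasLaw X (multivariateGaussian 0 M) μ)
    (i j : Fin k) : ∫ ω, X ω i * X ω j ∂μ = M i j := by
  have h1 := covariance_eval_multivariateGaussian (μ := (0 : EuclideanSpace ℝ (Fin k))) hM i j
  rw [← hX.covariance_fun_comp (by fun_prop) (by fun_prop),
    covariance_eq_sub (memLp_of_hasLaw_gaussian hX i) (memLp_of_hasLaw_gaussian hX j),
    integral_of_hasLaw_gaussian hX] at h1
  simpa using h1

theorem measurable_coord {k : ℕ} (i : Fin k) :
    Measurable fun x : EuclideanSpace ℝ (Fin k) => x i := by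
  fun_prop

variable (N : S.RandomInputs q μ)

theorem memLp_noise (t : ℕ) : MemLp (N.noise t) 2 μ := by
  rw [memLp_pi_iff]
  intro i
  cases i with
  | inl i => exact memLp_of_hasLaw_gaussian (N.law_w t) i
  | inr i => exact memLp_of_hasLaw_gaussian (N.law_v t) i

theorem integral_noise (t : ℕ) (i : Fin n ⊕ Fin p) : ∫ ω, N.noise t ω i ∂μ = 0 := by
  cases i with
  | inl i => exact integral_of_hasLaw_gaussian (N.law_w t) i
  | inr i => exact integral_of_hasLaw_gaussian (N.law_v t) i

/-- The coordinates of the stacked noise, as functions of the pair `(w_t, v_t)`. -/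
def stack (i : Fin n ⊕ Fin p) (x : EuclideanSpace ℝ (Fin n) × EuclideanSpace ℝ (Fin p)) : ℝ :=
  Sum.elim x.1 x.2 i

theorem measurable_stack (i : Fin n ⊕ Fin p) : Measurable (stack i) := by
  cases i with
  | inl i => exact (measurable_coord i).comp measurable_fst
  | inr i => exact (measurable_coord i).comp measurable_snd

theorem crossMoment_noise_of_ne {s t : ℕ} (hst : s ≠ t) :
    crossMoment μ (N.noise s) (N.noise t) = 0 := by
  ext i j
  have h1 : IndepFun (fun ω => N.noise s ω i) (fun ω => N.noise t ω j) μ :=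
    (N.indep_time.indepFun hst).comp (measurable_stack i) (measurable_stack j)
  have h2 := h1.integral_fun_mul_eq_mul_integral
    ((N.memLp_noise s).eval i).aestronglyMeasurable
    ((N.memLp_noise t).eval j).aestronglyMeasurable
  simpa [crossMoment, N.integral_noise] using h2

theorem crossMoment_noise_self [IsProbabilityMeasure μ] (t : ℕ) :
    crossMoment μ (N.noise t) (N.noise t) = S.noiseCov := by
  have hwv : ∀ (i : Fin n) (j : Fin p), ∫ ω, N.w t ω i * N.v t ω j ∂μ = 0 := by
    intro i j
    have h1 : IndepFun (fun ω => N.w t ω i) (fun ω => N.v t ω j) μ :=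
      (N.indep_w_v t).comp (measurable_coord i) (measurable_coord j)
    have h2 := h1.integral_fun_mul_eq_mul_integral
      (memLp_of_hasLaw_gaussian (N.law_w t) i).aestronglyMeasurable
      (memLp_of_hasLaw_gaussian (N.law_v t) j).aestronglyMeasurable
    simpa [integral_of_hasLaw_gaussian (N.law_w t)] using h2
  ext i j
  rcases i with i | i <;> rcases j with j | j <;>
    simp only [crossMoment, noise, noiseCov, of_apply, Sum.elim_inl, Sum.elim_inr,
      fromBlocks_apply₁₁, fromBlocks_apply₁₂, fromBlocks_apply₂₁, fromBlocks_apply₂₂, Matrix.zero_apply]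
  · exact integral_mul_of_hasLaw_gaussian S.posSemidef_W (N.law_w t) i j
  · exact hwv i j
  · simpa only [mul_comm] using hwv j i
  · exact integral_mul_of_hasLaw_gaussian S.posDef_V.posSemidef (N.law_v t) i j

end RandomInputs

/-- The stacked closed-loop state `(x_t, ξ_t)`. -/
def state (N : S.RandomInputs q μ) (K : Controller m p q) (t : ℕ) (ω : Ω) : Fin n ⊕ Fin q → ℝ :=
  Sum.elim (S.trajectory N K t ω).1 (S.trajectory N K t ω).2

theorem isLinearRecursion_state [IsProbabilityMeasure μ] (N : S.RandomInputs q μ)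
    (K : Controller m p q) :
    IsLinearRecursion μ (S.closedLoop K) (S.noiseInput K) S.noiseCov (state N K) N.noise where
  step t ω := by
    simp only [state, RandomInputs.noise, closedLoop, noiseInput, trajectory, fromBlocks_mulVec,
      Sum.elim_comp_inl, Sum.elim_comp_inr]
    ext i
    cases i <;> simp [mulVec_add, add_assoc, add_comm, add_left_comm]
  memLp_init := by
    rw [memLp_pi_iff]
    intro i
    cases i with
    | inl i => exact N.memLp_x0.eval i
    | inr i => exact N.memLp_xi0.eval i
  memLp_noise := N.memLp_noise
  init_noise t := by
    ext i j
    have hi : Measurable fun x : (Fin n → ℝ) × (Fin q → ℝ) =>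
        (Sum.elim x.1 x.2 i : ℝ) := by
      cases i <;> simp only [Sum.elim_inl, Sum.elim_inr] <;> fun_prop
    have h1 : IndepFun (fun ω => state N K 0 ω i) (fun ω => N.noise t ω j) μ :=
      N.indep_init.comp hi ((RandomInputs.measurable_stack j).comp (measurable_pi_apply t))
    have hm : AEStronglyMeasurable (fun ω => state N K 0 ω i) μ :=
      (hi.comp (N.measurable_x0.prodMk N.measurable_xi0)).aestronglyMeasurable
    have h2 := h1.integral_fun_mul_eq_mul_integral hm
      ((N.memLp_noise t).eval j).aestronglyMeasurable
    simpa [crossMoment, N.integral_noise] using h2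
  noise_noise _ _ h := N.crossMoment_noise_of_ne h
  noise_cov := N.crossMoment_noise_self

theorem stageCost_eq (N : S.RandomInputs q μ) (K : Controller m p q) (t : ℕ) (ω : Ω) :
    S.stageCost N K t ω = state N K t ω ⬝ᵥ (S.closedLoopWeight K *ᵥ state N K t ω) := by
  simp only [stageCost, state, closedLoopWeight, fromBlocks_mulVec, Sum.elim_comp_inl,
    Sum.elim_comp_inr, zero_mulVec, add_zero, zero_add, sumElim_dotProduct_sumElim]
  congr 1
  rw [← mulVec_mulVec, ← mulVec_mulVec, dotProduct_mulVec _ K.CKᵀ, vecMul_transpose]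

theorem integrable_stageCost [IsProbabilityMeasure μ] (N : S.RandomInputs q μ)
    (K : Controller m p q) (t : ℕ) : Integrable (S.stageCost N K t) μ := by
  rw [funext (stageCost_eq N K t)]
  exact integrable_dotProduct_mulVec ((isLinearRecursion_state N K).memLp t) _

theorem tendsto_averageCost [IsProbabilityMeasure μ] (N : S.RandomInputs q μ)
    {K : Controller m p q} (hK : K ∈ S.stabilizing q)
    {X : Matrix (Fin n ⊕ Fin q) (Fin n ⊕ Fin q) ℝ}
    (hX : X = S.closedLoop K * X * (S.closedLoop K)ᵀ + S.closedLoopNoise K) :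
    Tendsto (S.averageCost N K) atTop (𝓝 (S.closedLoopWeight K * X).trace) := by
  rw [← noiseInput_mul_noiseCov] at hX
  have h := (isLinearRecursion_state N K).tendsto_average (mem_stabilizing_iff.1 hK) hX
    (S.closedLoopWeight K)
  refine h.congr fun T => ?_
  simp only [averageCost, stageCost_eq]

theorem cost_eq [IsProbabilityMeasure μ] (N : S.RandomInputs q μ)
    {K : Controller m p q} (hK : K ∈ S.stabilizing q)
    {X : Matrix (Fin n ⊕ Fin q) (Fin n ⊕ Fin q) ℝ}
    (hX : X = S.closedLoop K * X * (S.closedLoop K)ᵀ + S.closedLoopNoise K) :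
    S.cost N K = (S.closedLoopWeight K * X).trace :=
  (tendsto_averageCost N hK hX).limUnder_eq

theorem tendsto_averageCost_cost [IsProbabilityMeasure μ] (N : S.RandomInputs q μ)
    {K : Controller m p q} (hK : K ∈ S.stabilizing q) :
    Tendsto (S.averageCost N K) atTop (𝓝 (S.cost N K)) := by
  obtain ⟨X, hX⟩ := (mem_stabilizing_iff.1 hK).exists_lyapunov (S.closedLoopNoise K)
  rw [cost_eq N hK hX]
  exact tendsto_averageCost N hK hX

end Cost

end LQGSystem

/-! ### Controllability and observability -/

section Controllability

theorem Matrix.exists_mul_eq_one_of_rank_eq {ι κ : Type*} [Fintype ι] [DecidableEq ι] [Fintype κ]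
    {M : Matrix ι κ ℝ} (h : M.rank = Fintype.card ι) : ∃ N : Matrix κ ι ℝ, M * N = 1 := by
  classical
  refine mulVec_surjective_iff_exists_right_inverse.1 ?_
  have h1 : LinearMap.range M.mulVecLin = ⊤ := by
    refine Submodule.eq_top_of_finrank_eq ?_
    rw [Module.finrank_fintype_fun_eq_card, ← h]
    rfl
  exact LinearMap.range_eq_top.1 h1

/-- The `U i` are the blocks of a right inverse of the controllability matrix; they serve as inputs
steering 0 to any prescribed state. -/
theorem IsControllablePair.exists_sum_eq_one {k l : ℕ} {A : Matrix (Fin k) (Fin k) ℝ}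
    {B : Matrix (Fin k) (Fin l) ℝ} (h : IsControllablePair A B) :
    ∃ U : ℕ → Matrix (Fin l) (Fin k) ℝ, ∑ i ∈ Finset.range k, A ^ i * B * U i = 1 := by
  obtain ⟨N, hN⟩ := Matrix.exists_mul_eq_one_of_rank_eq (M := controllabilityMatrix A B)
    (by rw [Fintype.card_fin]; exact h)
  refine ⟨fun i => if hi : i < k then Matrix.of fun a c => N (⟨i, hi⟩, a) c else 0, ?_⟩
  rw [Finset.sum_range, ← hN]
  ext a b
  simp [Matrix.sum_apply, Matrix.mul_apply, controllabilityMatrix, Fintype.sum_prod_type]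

theorem isObservablePair_iff_transpose {k l : ℕ} {C : Matrix (Fin l) (Fin k) ℝ}
    {A : Matrix (Fin k) (Fin k) ℝ} : IsObservablePair C A ↔ IsControllablePair Aᵀ Cᵀ := by
  have h : observabilityMatrix C A = (controllabilityMatrix Aᵀ Cᵀ)ᵀ := by
    ext i j
    simp only [observabilityMatrix, controllabilityMatrix, of_apply, transpose_apply]
    rw [← transpose_pow, ← transpose_mul, transpose_apply]
  rw [IsObservablePair, IsControllablePair, h, rank_transpose]

theorem isControllablePair_iff_transpose {k l : ℕ} {A : Matrix (Fin k) (Fin k) ℝ}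
    {B : Matrix (Fin k) (Fin l) ℝ} : IsControllablePair A B ↔ IsObservablePair Bᵀ Aᵀ := by
  rw [isObservablePair_iff_transpose, transpose_transpose, transpose_transpose]

theorem IsObservablePair.exists_sum_eq_one {k l : ℕ} {C : Matrix (Fin l) (Fin k) ℝ}
    {A : Matrix (Fin k) (Fin k) ℝ} (h : IsObservablePair C A) :
    ∃ U : ℕ → Matrix (Fin k) (Fin l) ℝ, ∑ i ∈ Finset.range k, U i * (C * A ^ i) = 1 := by
  obtain ⟨U, hU⟩ := (isObservablePair_iff_transpose.1 h).exists_sum_eq_one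
  refine ⟨fun i => (U i)ᵀ, ?_⟩
  have := congrArg transpose hU
  simpa [transpose_sum, transpose_pow] using this

theorem IsObservablePair.eq_zero {k l : ℕ} {C : Matrix (Fin l) (Fin k) ℝ}
    {A : Matrix (Fin k) (Fin k) ℝ} (h : IsObservablePair C A) {x : Fin k → ℝ}
    (hx : ∀ i : ℕ, C *ᵥ (A ^ i *ᵥ x) = 0) : x = 0 := by
  obtain ⟨U, hU⟩ := h.exists_sum_eq_one
  rw [← one_mulVec x, ← hU, sum_mulVec]
  refine Finset.sum_eq_zero fun i _ => ?_
  rw [← mulVec_mulVec, ← mulVec_mulVec, hx, mulVec_zero]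

/-- In the definiteness proofs `p` is the vanishing of a positive semidefinite quadratic form. -/
theorem IsObservablePair.eq_zero_of_invariant {k l : ℕ} {C : Matrix (Fin l) (Fin k) ℝ}
    {A : Matrix (Fin k) (Fin k) ℝ} (h : IsObservablePair C A) (p : (Fin k → ℝ) → Prop)
    (hA : ∀ x, p x → p (A *ᵥ x)) (hC : ∀ x, p x → C *ᵥ x = 0) {x : Fin k → ℝ} (hx : p x) :
    x = 0 := by
  refine h.eq_zero fun i => hC _ ?_
  induction i with
  | zero => simpa using hx
  | succ i ih => rw [pow_succ', ← mulVec_mulVec]; exact hA _ ih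

end Controllability

/-! ### Square roots and quadratic forms -/

namespace Matrix

variable {k : ℕ} {κ : Type*} [Fintype κ]

theorem matrixSqrt_mulVec_eq_zero {M : Matrix (Fin k) (Fin k) ℝ} (hM : M.PosSemidef)
    {x : Fin k → ℝ} (hx : x ⬝ᵥ (M *ᵥ x) = 0) : matrixSqrt M *ᵥ x = 0 := by
  obtain ⟨h1, h2⟩ := matrixSqrt_spec hM
  have h3 : (matrixSqrt M *ᵥ x) ⬝ᵥ (matrixSqrt M *ᵥ x) = 0 := by
    rw [dotProduct_mulVec, ← mulVec_transpose, h1.transpose_eq, mulVec_mulVec, h2,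
      dotProduct_comm, hx]
  exact dotProduct_self_eq_zero.1 h3

theorem PosDef.eq_zero_of_dotProduct_mulVec {ι : Type*} [Fintype ι] {M : Matrix ι ι ℝ}
    (hM : M.PosDef) {x : ι → ℝ} (hx : x ⬝ᵥ (M *ᵥ x) = 0) : x = 0 := by
  by_contra h
  have := hM.dotProduct_mulVec_pos h
  simp [hx] at this

/-- The trace is the sum of the squared entries of M^{1/2} X. -/
theorem tendsto_matrixSqrt_mul {M : Matrix (Fin k) (Fin k) ℝ} (hM : M.PosSemidef)
    {X : ℕ → Matrix (Fin k) κ ℝ}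
    (hX : Tendsto (fun t => ((X t)ᵀ * M * X t).trace) atTop (𝓝 0)) :
    Tendsto (fun t => matrixSqrt M * X t) atTop (𝓝 0) := by
  obtain ⟨h1, h2⟩ := matrixSqrt_spec hM
  have h3 : ∀ t, ((X t)ᵀ * M * X t).trace = ∑ j, ∑ i, (matrixSqrt M * X t) i j ^ 2 := by
    intro t
    have : (X t)ᵀ * M * X t = (matrixSqrt M * X t)ᵀ * (matrixSqrt M * X t) := by
      rw [transpose_mul, h1.transpose_eq]
      conv_lhs => rw [← h2]
      simp only [Matrix.mul_assoc]
    rw [this]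
    simp only [trace, diag_apply, Matrix.mul_apply, transpose_apply, sq]
  refine tendsto_pi_nhds.2 fun i => tendsto_pi_nhds.2 fun j => ?_
  have h4 : Tendsto (fun t => (matrixSqrt M * X t) i j ^ 2) atTop (𝓝 0) := by
    refine squeeze_zero (fun t => sq_nonneg _) (fun t => ?_) hX
    rw [h3]
    exact (Finset.single_le_sum (f := fun i => (matrixSqrt M * X t) i j ^ 2)
      (fun _ _ => sq_nonneg _) (Finset.mem_univ i)).trans
      (Finset.single_le_sum (f := fun j => ∑ i, (matrixSqrt M * X t) i j ^ 2)
      (fun _ _ => Finset.sum_nonneg fun _ _ => sq_nonneg _) (Finset.mem_univ j))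
  have h5 : Tendsto (fun t => |(matrixSqrt M * X t) i j|) atTop (𝓝 0) := by
    simpa [Real.sqrt_sq_eq_abs] using h4.sqrt
  exact (tendsto_zero_iff_abs_tendsto_zero _).2 h5

theorem PosDef.tendsto_zero {M : Matrix (Fin k) (Fin k) ℝ} (hM : M.PosDef)
    {X : ℕ → Matrix (Fin k) κ ℝ}
    (hX : Tendsto (fun t => ((X t)ᵀ * M * X t).trace) atTop (𝓝 0)) :
    Tendsto X atTop (𝓝 0) := by
  have h1 := tendsto_matrixSqrt_mul hM.posSemidef hX
  have hc : Continuous fun Z : Matrix (Fin k) κ ℝ => M⁻¹ * (matrixSqrt M * Z) := by fun_prop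
  have h2 := (hc.tendsto 0).comp h1
  have hu : IsUnit M.det := (isUnit_iff_isUnit_det _).1 hM.isUnit
  rw [Matrix.mul_zero, Matrix.mul_zero] at h2
  refine h2.congr fun t => ?_
  simp only [Function.comp_def]
  rw [← Matrix.mul_assoc (matrixSqrt M), (matrixSqrt_spec hM.posSemidef).2,
    ← Matrix.mul_assoc, nonsing_inv_mul _ hu, Matrix.one_mul]

end Matrix

/-! ### Monotone convergence of symmetric matrices -/

namespace Matrix

/-- Each quadratic form is monotone and bounded, hence converges; polarization with eᵢ ± eⱼ recovers
the entries. -/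
theorem exists_tendsto_of_monotone {ι : Type*} [Fintype ι] [DecidableEq ι]
    {Y : ℕ → Matrix ι ι ℝ} (hY : ∀ k, (Y k)ᵀ = Y k) (hmono : ∀ k, (Y (k + 1) - Y k).PosSemidef)
    (hbdd : ∀ x : ι → ℝ, ∃ c, ∀ k, x ⬝ᵥ (Y k *ᵥ x) ≤ c) :
    ∃ L, Tendsto Y atTop (𝓝 L) := by
  have hq : ∀ x : ι → ℝ, ∃ l, Tendsto (fun k => x ⬝ᵥ (Y k *ᵥ x)) atTop (𝓝 l) := by
    intro x
    obtain ⟨c, hc⟩ := hbdd x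
    refine ⟨_, tendsto_atTop_ciSup (monotone_nat_of_le_succ fun k => ?_)
      ⟨c, by rintro _ ⟨k, rfl⟩; exact hc k⟩⟩
    have := (hmono k).dotProduct_nonneg x
    rw [sub_mulVec, dotProduct_sub] at this
    linarith
  choose l hl using hq
  have hentry : ∀ k i j, Y k i j =
      ((Pi.single i 1 + Pi.single j 1 : ι → ℝ) ⬝ᵥ (Y k *ᵥ (Pi.single i 1 + Pi.single j 1)) -
        (Pi.single i 1 - Pi.single j 1 : ι → ℝ) ⬝ᵥ (Y k *ᵥ (Pi.single i 1 - Pi.single j 1))) /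
        4 := by
    intro k i j
    have hs : Y k j i = Y k i j := by
      conv_lhs => rw [← hY k]
      rfl
    simp only [mulVec_add, mulVec_sub, add_dotProduct, sub_dotProduct, dotProduct_add,
      dotProduct_sub, mulVec_single_one, single_one_dotProduct, col_apply, hs]
    ring
  refine ⟨Matrix.of fun i j => (l (Pi.single i 1 + Pi.single j 1) -
    l (Pi.single i 1 - Pi.single j 1)) / 4, tendsto_pi_nhds.2 fun i => tendsto_pi_nhds.2 fun j => ?_⟩
  simp only [hentry]
  exact ((hl _).sub (hl _)).div_const 4

end Matrix

/-! ### Value iteration and existence of a Riccati solution -/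

namespace LQGSystem

variable {n m p : ℕ} (S : LQGSystem n m p)

/-- One step `Y ↦ Aᵀ Y A - Aᵀ Y B (Bᵀ Y B + R)⁻¹ Bᵀ Y A + Q` of value iteration. -/
noncomputable def riccatiStep (Y : Matrix (Fin n) (Fin n) ℝ) : Matrix (Fin n) (Fin n) ℝ :=
  S.Aᵀ * Y * S.A - S.Aᵀ * Y * S.B * (S.Bᵀ * Y * S.B + S.R)⁻¹ * S.Bᵀ * Y * S.A + S.Q

/-- The weight `Bᵀ Y B + R`. -/
def inputWeight (Y : Matrix (Fin n) (Fin n) ℝ) : Matrix (Fin m) (Fin m) ℝ :=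
  S.Bᵀ * Y * S.B + S.R

variable {S} {Y Y' : Matrix (Fin n) (Fin n) ℝ}

theorem posDef_inputWeight (hY : Y.PosSemidef) : (S.inputWeight Y).PosDef :=
  Matrix.PosDef.posSemidef_add (hY.transpose_mul_mul S.B) S.posDef_R

theorem isUnit_det_inputWeight (hY : Y.PosSemidef) : IsUnit (S.inputWeight Y).det :=
  (isUnit_iff_isUnit_det _).1 (posDef_inputWeight hY).isUnit

theorem inputWeight_mul_feedbackGain (hY : Y.PosSemidef) :
    S.inputWeight Y * S.feedbackGain Y = S.Bᵀ * Y * S.A := by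
  have h : S.inputWeight Y * (S.Bᵀ * Y * S.B + S.R)⁻¹ = 1 :=
    mul_nonsing_inv _ (isUnit_det_inputWeight (S := S) hY)
  simp only [feedbackGain]
  simp only [← Matrix.mul_assoc, h, Matrix.one_mul]

theorem feedbackGain_transpose_mul (hY : Y.PosSemidef) :
    (S.feedbackGain Y)ᵀ * S.inputWeight Y = S.Aᵀ * Y * S.B := by
  have h := congrArg transpose (inputWeight_mul_feedbackGain (S := S) hY)
  simpa [hY.transpose_eq, (posDef_inputWeight hY).transpose_eq, Matrix.mul_assoc] using h

theorem riccatiStep_eq : S.riccatiStep Y =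
    S.Aᵀ * Y * S.A - S.Aᵀ * Y * S.B * S.feedbackGain Y + S.Q := by
  simp only [riccatiStep, feedbackGain, Matrix.mul_assoc]

/-- Completion of squares. -/
theorem stage_add_eq_riccatiStep_add {κ : Type*} (hY : Y.PosSemidef)
    (X : Matrix (Fin n) κ ℝ) (U : Matrix (Fin m) κ ℝ) :
    (S.A * X + S.B * U)ᵀ * Y * (S.A * X + S.B * U) + Uᵀ * S.R * U + Xᵀ * S.Q * X =
      Xᵀ * S.riccatiStep Y * X +
        (U + S.feedbackGain Y * X)ᵀ * S.inputWeight Y * (U + S.feedbackGain Y * X) := by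
  have h1 := inputWeight_mul_feedbackGain (S := S) hY
  have h2 := feedbackGain_transpose_mul (S := S) hY
  have h3 : (U + S.feedbackGain Y * X)ᵀ * S.inputWeight Y * (U + S.feedbackGain Y * X) =
      Uᵀ * S.inputWeight Y * U + Uᵀ * (S.Bᵀ * Y * S.A) * X + Xᵀ * (S.Aᵀ * Y * S.B) * U +
        Xᵀ * (S.Aᵀ * Y * S.B * S.feedbackGain Y) * X := by
    rw [← h2, ← h1]
    simp only [transpose_add, transpose_mul, Matrix.add_mul, Matrix.mul_add, Matrix.mul_assoc]
    abel
  rw [h3, riccatiStep_eq, inputWeight]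
  simp only [transpose_add, transpose_mul, Matrix.add_mul, Matrix.mul_add, Matrix.mul_assoc,
    Matrix.sub_mul, Matrix.mul_sub]
  abel

/-- Completion of squares at X = 1, U = -G. It shows that `riccatiStep` is a minimum over all gains,
attained at `feedbackGain`. -/
theorem closedLoop_gain_eq (hY : Y.PosSemidef) (G : Matrix (Fin m) (Fin n) ℝ) :
    (S.A - S.B * G)ᵀ * Y * (S.A - S.B * G) + Gᵀ * S.R * G + S.Q =
      S.riccatiStep Y + (S.feedbackGain Y - G)ᵀ * S.inputWeight Y * (S.feedbackGain Y - G) := by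
  have h := stage_add_eq_riccatiStep_add (S := S) hY 1 (-G)
  simpa [sub_eq_add_neg, add_comm] using h

theorem riccatiStep_eq_closedLoop (hY : Y.PosSemidef) :
    S.riccatiStep Y = (S.A - S.B * S.feedbackGain Y)ᵀ * Y * (S.A - S.B * S.feedbackGain Y) +
      (S.feedbackGain Y)ᵀ * S.R * S.feedbackGain Y + S.Q := by
  simpa using (closedLoop_gain_eq (S := S) hY (S.feedbackGain Y)).symm

theorem posSemidef_riccatiStep (hY : Y.PosSemidef) : (S.riccatiStep Y).PosSemidef := by
  rw [riccatiStep_eq_closedLoop hY]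
  exact ((hY.transpose_mul_mul _).add (S.posDef_R.posSemidef.transpose_mul_mul _)).add
    S.posSemidef_Q

/-- A minimum over gains of maps monotone in Y is monotone: the optimal gain for Y' is merely
admissible for Y. -/
theorem posSemidef_riccatiStep_sub (hY : Y.PosSemidef) (hY' : Y'.PosSemidef)
    (h : (Y' - Y).PosSemidef) : (S.riccatiStep Y' - S.riccatiStep Y).PosSemidef := by
  set G := S.feedbackGain Y' with hG
  have h1 := closedLoop_gain_eq (S := S) hY G
  have h2 : S.riccatiStep Y' - S.riccatiStep Y =
      (S.A - S.B * G)ᵀ * (Y' - Y) * (S.A - S.B * G) +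
        (S.feedbackGain Y - G)ᵀ * S.inputWeight Y * (S.feedbackGain Y - G) := by
    rw [← sub_eq_iff_eq_add'] at h1
    rw [riccatiStep_eq_closedLoop hY', ← hG, Matrix.mul_sub _ Y' Y,
      Matrix.sub_mul _ _ (S.A - S.B * G), ← h1]
    abel
  rw [h2]
  exact (h.transpose_mul_mul _).add ((posDef_inputWeight hY).posSemidef.transpose_mul_mul _)

variable (S) in
/-- The value iteration `Y_0 = 0`, `Y_{k+1} = riccatiStep Y_k`. -/
noncomputable def valueIteration : ℕ → Matrix (Fin n) (Fin n) ℝ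
  | 0 => 0
  | k + 1 => S.riccatiStep (valueIteration k)

theorem posSemidef_valueIteration (k : ℕ) : (S.valueIteration k).PosSemidef := by
  induction k with
  | zero => exact PosSemidef.zero
  | succ k ih => exact posSemidef_riccatiStep ih

theorem posSemidef_valueIteration_sub (k : ℕ) :
    (S.valueIteration (k + 1) - S.valueIteration k).PosSemidef := by
  induction k with
  | zero => simpa [valueIteration] using posSemidef_riccatiStep (S := S) PosSemidef.zero
  | succ k ih =>
    exact posSemidef_riccatiStep_sub (posSemidef_valueIteration k)
      (posSemidef_valueIteration (k + 1)) ih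

/-- Dynamic programming: the value at X is at most the stage cost of the input U plus the value,
with one step less to go, at A X + B U. -/
theorem exists_trace_valueIteration_le_step {κ : Type*} [Fintype κ] {X : Matrix (Fin n) κ ℝ}
    (U : Matrix (Fin m) κ ℝ)
    (h : ∃ c, ∀ k, ((S.A * X + S.B * U)ᵀ * S.valueIteration k * (S.A * X + S.B * U)).trace ≤ c) :
    ∃ c, ∀ k, (Xᵀ * S.valueIteration k * X).trace ≤ c := by
  obtain ⟨c, hc⟩ := h
  have hQ := ((S.posSemidef_Q.transpose_mul_mul X).trace_nonneg)
  have hR := ((S.posDef_R.posSemidef.transpose_mul_mul U).trace_nonneg)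
  have hc0 : 0 ≤ c := by simpa [valueIteration] using hc 0
  refine ⟨c + (Uᵀ * S.R * U).trace + (Xᵀ * S.Q * X).trace, fun k => ?_⟩
  cases k with
  | zero => simp only [valueIteration, Matrix.mul_zero, Matrix.zero_mul, trace_zero]; positivity
  | succ k =>
    have hk := posSemidef_valueIteration (S := S) k
    have h1 := congrArg trace (stage_add_eq_riccatiStep_add (S := S) hk X U)
    have h2 := ((posDef_inputWeight (S := S) hk).posSemidef.transpose_mul_mul
      (U + S.feedbackGain (S.valueIteration k) * X)).trace_nonneg
    simp only [trace_add] at h1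
    rw [valueIteration]
    linarith [hc k]

theorem exists_trace_valueIteration_le_of_steering {κ : Type*} [Fintype κ] (j : ℕ) :
    ∀ (X : Matrix (Fin n) κ ℝ) (U : ℕ → Matrix (Fin m) κ ℝ),
      S.A ^ j * X + ∑ i ∈ Finset.range j, S.A ^ i * S.B * U i = 0 →
      ∃ c, ∀ k, (Xᵀ * S.valueIteration k * X).trace ≤ c := by
  induction j with
  | zero =>
    intro X U h
    have hX : X = 0 := by simpa using h
    exact ⟨0, fun k => by simp [hX]⟩
  | succ j ih =>
    intro X U h
    -- `U j` carries the factor Aʲ, so it is the input applied first.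
    refine exists_trace_valueIteration_le_step (U j) (ih _ U ?_)
    rw [← h, Finset.sum_range_succ, pow_succ]
    simp only [Matrix.mul_add, Matrix.mul_assoc]
    abel

theorem exists_dotProduct_valueIteration_le (hAB : IsControllablePair S.A S.B) (x : Fin n → ℝ) :
    ∃ c, ∀ k, x ⬝ᵥ (S.valueIteration k *ᵥ x) ≤ c := by
  obtain ⟨U, hU⟩ := hAB.exists_sum_eq_one
  let X : Matrix (Fin n) Unit ℝ := replicateCol Unit x
  -- These inputs produce -Aⁿx and so cancel the free motion after n steps.
  obtain ⟨c, hc⟩ := exists_trace_valueIteration_le_of_steering (S := S) n X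
    (fun i => -(U i * (S.A ^ n * X))) (by
      have h1 : ∑ i ∈ Finset.range n, S.A ^ i * S.B * -(U i * (S.A ^ n * X)) =
          -((∑ i ∈ Finset.range n, S.A ^ i * S.B * U i) * (S.A ^ n * X)) := by
        rw [Matrix.sum_mul, ← Finset.sum_neg_distrib]
        exact Finset.sum_congr rfl fun i _ => by rw [Matrix.mul_neg, Matrix.mul_assoc _ (U i)]
      rw [h1, hU, Matrix.one_mul, add_neg_cancel])
  refine ⟨c, fun k => le_of_eq_of_le ?_ (hc k)⟩
  have h2 : S.valueIteration k * X = replicateCol Unit (S.valueIteration k *ᵥ x) := by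
    ext i j; simp [X, Matrix.mul_apply, mulVec, dotProduct]
  rw [Matrix.mul_assoc, h2]
  simp [X, trace, Matrix.mul_apply, dotProduct]

theorem exists_posSemidef_controlRiccati (hAB : IsControllablePair S.A S.B) :
    ∃ Y : Matrix (Fin n) (Fin n) ℝ, Y.PosSemidef ∧ S.ControlRiccati Y := by
  obtain ⟨Y, hY⟩ := exists_tendsto_of_monotone
    (fun k => (posSemidef_valueIteration (S := S) k).transpose_eq)
    posSemidef_valueIteration_sub (exists_dotProduct_valueIteration_le hAB)
  have hpsd : Y.PosSemidef := by
    refine posSemidef_of_dotProduct_mulVec_nonneg ?_ fun x => ?_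
    · refine tendsto_nhds_unique ((continuous_id.matrix_transpose.tendsto Y).comp hY) ?_
      exact hY.congr fun k => (posSemidef_valueIteration (S := S) k).transpose_eq.symm
    · have hc : Continuous fun Z : Matrix (Fin n) (Fin n) ℝ => x ⬝ᵥ (Z *ᵥ x) := by fun_prop
      exact ge_of_tendsto' ((hc.tendsto Y).comp hY) fun k =>
        (posSemidef_valueIteration (S := S) k).dotProduct_nonneg x
  refine ⟨Y, hpsd, ?_⟩
  have hinv : Tendsto (fun k => (S.inputWeight (S.valueIteration k))⁻¹) atTop
      (𝓝 (S.inputWeight Y)⁻¹) := by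
    have hc : Continuous S.inputWeight := by unfold inputWeight; fun_prop
    have hdet : (S.inputWeight Y).det ≠ 0 := (isUnit_det_inputWeight hpsd).ne_zero
    have := continuousAt_matrix_inv (S.inputWeight Y)
      (by simpa [Ring.inverse_eq_inv'] using continuousAt_inv₀ hdet)
    exact this.tendsto.comp ((hc.tendsto Y).comp hY)
  have hstep : Tendsto (fun k => S.riccatiStep (S.valueIteration k)) atTop
      (𝓝 (S.riccatiStep Y)) := by
    have hc : Continuous fun Z : Matrix (Fin n) (Fin n) ℝ × Matrix (Fin m) (Fin m) ℝ =>
        S.Aᵀ * Z.1 * S.A - S.Aᵀ * Z.1 * S.B * Z.2 * S.Bᵀ * Z.1 * S.A + S.Q := by fun_prop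
    have h := (hc.tendsto (Y, (S.inputWeight Y)⁻¹)).comp (hY.prodMk_nhds hinv)
    simpa only [Function.comp_def, riccatiStep, inputWeight] using h
  exact tendsto_nhds_unique ((tendsto_add_atTop_iff_nat 1).2 hY) hstep

end LQGSystem

/-! ### Definiteness, stability and uniqueness for the control Riccati equation -/

namespace LQGSystem

variable {n m p : ℕ} {S : LQGSystem n m p} {Y Y' : Matrix (Fin n) (Fin n) ℝ}

theorem ControlRiccati.eq_closedLoop (h : S.ControlRiccati Y) (hY : Y.PosSemidef) :
    Y = (S.A - S.B * S.feedbackGain Y)ᵀ * Y * (S.A - S.B * S.feedbackGain Y) +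
      (S.feedbackGain Y)ᵀ * S.R * S.feedbackGain Y + S.Q :=
  Eq.trans h (riccatiStep_eq_closedLoop hY)

theorem dotProduct_transpose_mul_mul_mulVec {ι κ : Type*} [Fintype ι] [Fintype κ]
    (G : Matrix ι κ ℝ) (M : Matrix ι ι ℝ) (x : κ → ℝ) :
    x ⬝ᵥ ((Gᵀ * M * G) *ᵥ x) = (G *ᵥ x) ⬝ᵥ (M *ᵥ (G *ᵥ x)) := by
  rw [← mulVec_mulVec, ← mulVec_mulVec, dotProduct_mulVec x, vecMul_transpose]

/-- If xᵀYx = 0, every term of the closed-loop form of the equation vanishes at x: K x = 0, Q^{1/2}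
x = 0, and (A - B K) x = A x is again in the kernel. Observability then forces x = 0. -/
theorem ControlRiccati.posDef (h : S.ControlRiccati Y) (hY : Y.PosSemidef)
    (hQ : IsObservablePair (matrixSqrt S.Q) S.A) : Y.PosDef := by
  have hE := h.eq_closedLoop hY
  have key : ∀ x : Fin n → ℝ, x ⬝ᵥ (Y *ᵥ x) = 0 →
      S.feedbackGain Y *ᵥ x = 0 ∧ matrixSqrt S.Q *ᵥ x = 0 ∧
        ((S.A - S.B * S.feedbackGain Y) *ᵥ x) ⬝ᵥ
          (Y *ᵥ ((S.A - S.B * S.feedbackGain Y) *ᵥ x)) = 0 := by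
    intro x hx
    have h1 : x ⬝ᵥ (Y *ᵥ x) = ((S.A - S.B * S.feedbackGain Y) *ᵥ x) ⬝ᵥ
          (Y *ᵥ ((S.A - S.B * S.feedbackGain Y) *ᵥ x)) +
        (S.feedbackGain Y *ᵥ x) ⬝ᵥ (S.R *ᵥ (S.feedbackGain Y *ᵥ x)) + x ⬝ᵥ (S.Q *ᵥ x) := by
      rw [← dotProduct_transpose_mul_mul_mulVec, ← dotProduct_transpose_mul_mul_mulVec,
        ← dotProduct_add, ← dotProduct_add, ← add_mulVec, ← add_mulVec, ← hE]
    have h2 := hY.dotProduct_nonneg ((S.A - S.B * S.feedbackGain Y) *ᵥ x)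
    have h3 := S.posDef_R.posSemidef.dotProduct_nonneg (S.feedbackGain Y *ᵥ x)
    have h4 := S.posSemidef_Q.dotProduct_nonneg x
    exact ⟨S.posDef_R.eq_zero_of_dotProduct_mulVec (by linarith),
      matrixSqrt_mulVec_eq_zero S.posSemidef_Q (by linarith), by linarith⟩
  refine .of_dotProduct_mulVec_pos hY.1 fun {x} hx => ?_
  rw [star_trivial]
  refine lt_of_le_of_ne (hY.dotProduct_nonneg x) fun h0 => hx ?_
  refine hQ.eq_zero_of_invariant (fun x => x ⬝ᵥ (Y *ᵥ x) = 0) (fun z hz => ?_)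
    (fun z hz => (key z hz).2.1) h0.symm
  obtain ⟨h1, -, h3⟩ := key z hz
  rwa [sub_mulVec, ← mulVec_mulVec, h1, mulVec_zero, sub_zero] at h3

/-- With F = A - B K, the traces of (Fᵏ)ᵀ Y Fᵏ decrease to a limit, so their decrements, which
dominate the stage costs, tend to 0. Hence K Fᵏ → 0 and Q^{1/2} Fᵏ → 0, and observability upgrades
this to Fᵏ → 0. -/
theorem ControlRiccati.isStable (h : S.ControlRiccati Y) (hY : Y.PosSemidef)
    (hQ : IsObservablePair (matrixSqrt S.Q) S.A) :
    (S.A - S.B * S.feedbackGain Y).IsStable := by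
  have hE := h.eq_closedLoop hY
  set G := S.feedbackGain Y with hG
  set F := S.A - S.B * G with hF
  have hstep : ∀ k : ℕ, ((F ^ k)ᵀ * Y * F ^ k).trace =
      ((F ^ (k + 1))ᵀ * Y * F ^ (k + 1)).trace + ((G * F ^ k)ᵀ * S.R * (G * F ^ k)).trace +
        ((F ^ k)ᵀ * S.Q * F ^ k).trace := by
    intro k
    rw [← trace_add, ← trace_add]
    congr 1
    conv_lhs => rw [hE]
    rw [pow_succ']
    simp only [transpose_mul, Matrix.mul_add, Matrix.add_mul, Matrix.mul_assoc]
  have hnn : ∀ (k : ℕ), 0 ≤ ((F ^ k)ᵀ * Y * F ^ k).trace := fun k =>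
    (hY.transpose_mul_mul _).trace_nonneg
  have hR : ∀ (k : ℕ), 0 ≤ ((G * F ^ k)ᵀ * S.R * (G * F ^ k)).trace := fun k =>
    (S.posDef_R.posSemidef.transpose_mul_mul _).trace_nonneg
  have hQ' : ∀ (k : ℕ), 0 ≤ ((F ^ k)ᵀ * S.Q * F ^ k).trace := fun k =>
    (S.posSemidef_Q.transpose_mul_mul _).trace_nonneg
  have hanti : Antitone fun k : ℕ => ((F ^ k)ᵀ * Y * F ^ k).trace :=
    antitone_nat_of_succ_le fun k => by linarith [hstep k, hR k, hQ' k]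
  have hlim := tendsto_atTop_ciInf hanti ⟨0, by rintro _ ⟨k, rfl⟩; exact hnn k⟩
  have hdiff : Tendsto (fun k : ℕ => ((F ^ k)ᵀ * Y * F ^ k).trace -
      ((F ^ (k + 1))ᵀ * Y * F ^ (k + 1)).trace) atTop (𝓝 0) := by
    simpa using hlim.sub ((tendsto_add_atTop_iff_nat 1).2 hlim)
  have hGF : Tendsto (fun k : ℕ => G * F ^ k) atTop (𝓝 0) :=
    S.posDef_R.tendsto_zero (squeeze_zero hR
      (fun k => by linarith [hstep k, hR k, hQ' k]) hdiff)
  have hQF : Tendsto (fun k : ℕ => matrixSqrt S.Q * F ^ k) atTop (𝓝 0) :=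
    tendsto_matrixSqrt_mul S.posSemidef_Q (squeeze_zero hQ'
      (fun k => by linarith [hstep k, hR k, hQ' k]) hdiff)
  -- Since A = F + B K, one has Aʲ⁺¹ Fᵏ = Aʲ Fᵏ⁺¹ + Aʲ B (K Fᵏ), and both terms are under control.
  have hobs : ∀ j : ℕ, Tendsto (fun k : ℕ => matrixSqrt S.Q * S.A ^ j * F ^ k) atTop (𝓝 0) := by
    intro j
    induction j with
    | zero => simpa using hQF
    | succ j ih =>
      have hc : Continuous fun Z : Matrix (Fin m) (Fin n) ℝ =>
          matrixSqrt S.Q * S.A ^ j * S.B * Z := by fun_prop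
      have h1 := ((tendsto_add_atTop_iff_nat 1).2 ih).add ((hc.tendsto 0).comp hGF)
      rw [Matrix.mul_zero, add_zero] at h1
      refine h1.congr fun k => ?_
      have h2 : S.A = F + S.B * G := by rw [hF]; abel
      simp only [Function.comp_def]
      calc matrixSqrt S.Q * S.A ^ j * F ^ (k + 1) + matrixSqrt S.Q * S.A ^ j * S.B * (G * F ^ k)
          = matrixSqrt S.Q * S.A ^ j * (F + S.B * G) * F ^ k := by
            rw [pow_succ']
            simp only [Matrix.mul_add, Matrix.add_mul, Matrix.mul_assoc]
        _ = matrixSqrt S.Q * S.A ^ (j + 1) * F ^ k := by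
            rw [← h2, pow_succ]
            simp only [Matrix.mul_assoc]
  obtain ⟨U, hU⟩ := hQ.exists_sum_eq_one
  have hsum : Tendsto (fun k : ℕ => ∑ i ∈ Finset.range n,
      U i * (matrixSqrt S.Q * S.A ^ i * F ^ k)) atTop
      (𝓝 (∑ i ∈ Finset.range n, U i * (0 : Matrix (Fin n) (Fin n) ℝ))) := by
    refine tendsto_finsetSum _ fun i _ => ?_
    have hc : Continuous fun Z : Matrix (Fin n) (Fin n) ℝ => U i * Z := by fun_prop
    exact (hc.tendsto 0).comp (hobs i)
  simp only [Matrix.mul_zero, Finset.sum_const_zero] at hsum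
  refine hsum.congr fun k => ?_
  calc ∑ i ∈ Finset.range n, U i * (matrixSqrt S.Q * S.A ^ i * F ^ k)
      = (∑ i ∈ Finset.range n, U i * (matrixSqrt S.Q * S.A ^ i)) * F ^ k := by
        rw [Matrix.sum_mul]
        simp only [Matrix.mul_assoc]
    _ = F ^ k := by rw [hU, Matrix.one_mul]

/-- The difference satisfies the homogeneous equation Y - Y' = (A - B K)ᵀ (Y - Y') (A - B K') with
mixed gains, and both factors are stable. -/
theorem ControlRiccati.unique (h : S.ControlRiccati Y) (h' : S.ControlRiccati Y')
    (hY : Y.PosSemidef) (hY' : Y'.PosSemidef)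
    (hQ : IsObservablePair (matrixSqrt S.Q) S.A) : Y' = Y := by
  refine (sub_eq_zero.1 (IsStable.eq_zero_of_eq_mul_mul (h.isStable hY hQ).transpose
    (h'.isStable hY' hQ) ?_)).symm
  have e1 : Y = S.Aᵀ * Y * S.A - S.Aᵀ * Y * S.B * S.feedbackGain Y + S.Q :=
    Eq.trans h riccatiStep_eq
  have e2 : Y' = S.Aᵀ * Y' * S.A - S.Aᵀ * Y' * S.B * S.feedbackGain Y' + S.Q :=
    Eq.trans h' riccatiStep_eq
  have g1 := feedbackGain_transpose_mul (S := S) hY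
  have g2 := inputWeight_mul_feedbackGain (S := S) hY'
  have g1' : S.Aᵀ * Y * S.B * S.feedbackGain Y = (S.feedbackGain Y)ᵀ * (S.Bᵀ * Y * S.A) := by
    rw [← g1, ← inputWeight_mul_feedbackGain hY, Matrix.mul_assoc]
  set K := S.feedbackGain Y
  set K' := S.feedbackGain Y'
  have h1 : Kᵀ * S.inputWeight Y * K' = S.Aᵀ * Y * S.B * K' := by rw [g1]
  have h2 : Kᵀ * S.inputWeight Y' * K' = Kᵀ * (S.Bᵀ * Y' * S.A) := by rw [← g2, Matrix.mul_assoc]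
  have h3 : Kᵀ * S.Bᵀ * (Y - Y') * S.B * K' =
      S.Aᵀ * Y * S.B * K' - Kᵀ * (S.Bᵀ * Y' * S.A) := by
    rw [← h1, ← h2]
    simp only [inputWeight, Matrix.mul_add, Matrix.add_mul, Matrix.mul_sub, Matrix.sub_mul,
      Matrix.mul_assoc]
    abel
  calc Y - Y' = (S.Aᵀ * Y * S.A - Kᵀ * (S.Bᵀ * Y * S.A) + S.Q) -
        (S.Aᵀ * Y' * S.A - S.Aᵀ * Y' * S.B * K' + S.Q) := by rw [← g1', ← e1, ← e2]
    _ = S.Aᵀ * (Y - Y') * S.A - Kᵀ * (S.Bᵀ * (Y - Y') * S.A) - S.Aᵀ * (Y - Y') * S.B * K' +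
        (S.Aᵀ * Y * S.B * K' - Kᵀ * (S.Bᵀ * Y' * S.A)) := by
      simp only [Matrix.mul_sub, Matrix.sub_mul]
      abel
    _ = (S.A - S.B * K)ᵀ * (Y - Y') * (S.A - S.B * K') := by
      rw [← h3]
      simp only [transpose_sub, transpose_mul, Matrix.mul_sub, Matrix.sub_mul, Matrix.mul_assoc]
      abel

end LQGSystem

/-! ### Cost differences and the gradient -/

namespace Matrix

variable {ι : Type*} [Fintype ι]

theorem trace_fromBlocks {κ : Type*} [Fintype κ] (A : Matrix ι ι ℝ) (B : Matrix ι κ ℝ)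
    (C : Matrix κ ι ℝ) (D : Matrix κ κ ℝ) : (fromBlocks A B C D).trace = A.trace + D.trace := by
  simp [trace]

theorem trace_mul_eq_of_lyapunov {F Q Y : Matrix ι ι ℝ} (hY : Y = Fᵀ * Y * F + Q)
    (M : Matrix ι ι ℝ) : (Q * M).trace = (Y * (M - F * M * Fᵀ)).trace := by
  have h1 : (Y * (F * M * Fᵀ)).trace = (Fᵀ * Y * F * M).trace := by
    rw [← Matrix.mul_assoc, trace_mul_comm]
    simp only [Matrix.mul_assoc]
  have h2 : (Y * M).trace = (Fᵀ * Y * F * M).trace + (Q * M).trace := by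
    rw [← trace_add, ← Matrix.add_mul, ← hY]
  rw [Matrix.mul_sub, trace_sub, h1, h2]
  ring

/-- An exact first-order expansion: every term on the right contains an increment of the data.
Differentiating the cost thus requires only continuity of X', not its derivative. -/
theorem trace_sub_trace_of_lyapunov {F F' W W' Q Q' X X' Y : Matrix ι ι ℝ}
    (hX : X = F * X * Fᵀ + W) (hX' : X' = F' * X' * F'ᵀ + W') (hY : Y = Fᵀ * Y * F + Q) :
    (Q' * X').trace - (Q * X).trace = ((Q' - Q) * X').trace +
      (Y * (F' * X' * F'ᵀ - F * X' * Fᵀ)).trace + (Y * (W' - W)).trace := by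
  have h1 : X - F * X * Fᵀ = W := by
    rw [sub_eq_iff_eq_add']; exact hX
  have h2 : X' - F * X' * Fᵀ = F' * X' * F'ᵀ - F * X' * Fᵀ + W' := by
    rw [sub_add_eq_add_sub, ← hX']
  rw [Matrix.sub_mul, trace_sub, trace_mul_eq_of_lyapunov hY X', trace_mul_eq_of_lyapunov hY X,
    h1, h2, Matrix.mul_add, trace_add, Matrix.mul_sub Y W', trace_sub]
  ring

end Matrix

namespace LQGSystem

variable {n m p q : ℕ} {S : LQGSystem n m p}

/-- The derivative of the closed-loop matrix in the direction `D`. -/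
def closedLoopDeriv (S : LQGSystem n m p) (D : Controller m p q) :
    Matrix (Fin n ⊕ Fin q) (Fin n ⊕ Fin q) ℝ :=
  fromBlocks 0 (S.B * D.CK) (D.BK * S.C) D.AK

/-- The derivative of the closed-loop noise covariance at `K` in the direction `D`. -/
def closedLoopNoiseDeriv (S : LQGSystem n m p) (K D : Controller m p q) :
    Matrix (Fin n ⊕ Fin q) (Fin n ⊕ Fin q) ℝ :=
  fromBlocks 0 0 0 (D.BK * S.V * K.BKᵀ + K.BK * S.V * D.BKᵀ)

/-- The derivative of the closed-loop cost weight at `K` in the direction `D`. -/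
def closedLoopWeightDeriv (S : LQGSystem n m p) (K D : Controller m p q) :
    Matrix (Fin n ⊕ Fin q) (Fin n ⊕ Fin q) ℝ :=
  fromBlocks 0 0 0 (D.CKᵀ * S.R * K.CK + K.CKᵀ * S.R * D.CK)

theorem closedLoop_add_smul (K D : Controller m p q) (t : ℝ) :
    S.closedLoop (K + t • D) = S.closedLoop K + t • S.closedLoopDeriv D := by
  simp [closedLoop, closedLoopDeriv, Controller.AK, Controller.BK, Controller.CK,
    fromBlocks_add, fromBlocks_smul, Matrix.mul_add,
    Matrix.add_mul]

theorem closedLoopNoise_add_smul (K D : Controller m p q) (t : ℝ) :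
    S.closedLoopNoise (K + t • D) = S.closedLoopNoise K + t • (S.closedLoopNoiseDeriv K D +
      t • fromBlocks 0 0 0 (D.BK * S.V * D.BKᵀ)) := by
  simp only [closedLoopNoise, closedLoopNoiseDeriv, Controller.BK, fromBlocks_add, fromBlocks_smul, smul_zero,
    add_zero, Prod.fst_add, Prod.snd_add, Prod.smul_fst, Prod.smul_snd,
    transpose_add,
    transpose_smul, Matrix.mul_add, Matrix.add_mul, Matrix.mul_smul, Matrix.smul_mul, smul_add]
  congr 1
  abel

theorem closedLoopWeight_add_smul (K D : Controller m p q) (t : ℝ) :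
    S.closedLoopWeight (K + t • D) = S.closedLoopWeight K + t • (S.closedLoopWeightDeriv K D +
      t • fromBlocks 0 0 0 (D.CKᵀ * S.R * D.CK)) := by
  simp only [closedLoopWeight, closedLoopWeightDeriv, Controller.CK, fromBlocks_add, fromBlocks_smul, smul_zero,
    add_zero, Prod.snd_add, Prod.smul_snd, transpose_add,
    transpose_smul, Matrix.mul_add, Matrix.add_mul, Matrix.mul_smul, Matrix.smul_mul, smul_add]
  congr 1
  abel

theorem isOpen_stabilizing : IsOpen (S.stabilizing q) := by
  have h : S.stabilizing q = S.closedLoop ⁻¹' {F | F.IsStable} :=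
    Set.ext fun K => mem_stabilizing_iff
  rw [h]
  refine isOpen_setOf_isStable.preimage ?_
  unfold closedLoop
  exact Continuous.matrix_fromBlocks (by fun_prop) (by fun_prop) (by fun_prop) (by fun_prop)

section Stationary

variable {Ω : Type*} [MeasurableSpace Ω] {μ : Measure Ω} [IsProbabilityMeasure μ]
  {N : S.RandomInputs q μ} {K : Controller m p q}
  {X Y : Matrix (Fin n ⊕ Fin q) (Fin n ⊕ Fin q) ℝ}

theorem IsStationary.trace_eq_zero (hK : S.IsStationary N K)
    (hX : X = S.closedLoop K * X * (S.closedLoop K)ᵀ + S.closedLoopNoise K)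
    (hY : Y = (S.closedLoop K)ᵀ * Y * S.closedLoop K + S.closedLoopWeight K)
    (D : Controller m p q) :
    (S.closedLoopWeightDeriv K D * X).trace +
      (Y * (S.closedLoopDeriv D * X * (S.closedLoop K)ᵀ +
        S.closedLoop K * X * (S.closedLoopDeriv D)ᵀ)).trace +
      (Y * S.closedLoopNoiseDeriv K D).trace = 0 := by
  obtain ⟨hmem, hderiv⟩ := hK
  have hpath : Tendsto (fun t : ℝ => K + t • D) (𝓝[≠] 0) (𝓝 K) := by
    have hc : Continuous fun t : ℝ => K + t • D := by fun_prop
    have := (hc.tendsto 0).mono_left (nhdsWithin_le_nhds (s := {0}ᶜ))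
    simpa using this
  have hev : ∀ᶠ t : ℝ in 𝓝[≠] 0, K + t • D ∈ S.stabilizing q :=
    hpath.eventually (isOpen_stabilizing.mem_nhds hmem)
  -- Off the stabilizing set the value is a dummy; only small t matter, where the set's openness
  -- applies.
  have hsol : ∀ t : ℝ, ∃ Z, K + t • D ∈ S.stabilizing q →
      Z = S.closedLoop (K + t • D) * Z * (S.closedLoop (K + t • D))ᵀ +
        S.closedLoopNoise (K + t • D) := by
    intro t
    by_cases ht : K + t • D ∈ S.stabilizing q
    · obtain ⟨Z, hZ⟩ := (mem_stabilizing_iff.1 ht).exists_lyapunov (S.closedLoopNoise (K + t • D))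
      exact ⟨Z, fun _ => hZ⟩
    · exact ⟨0, fun h => absurd h ht⟩
  choose Z hZ using hsol
  have hid : Tendsto (fun t : ℝ => t) (𝓝[≠] 0) (𝓝 0) := nhdsWithin_le_nhds
  have hZlim : Tendsto Z (𝓝[≠] 0) (𝓝 X) := by
    refine (mem_stabilizing_iff.1 hmem).tendsto_lyapunov hX
      (F' := fun t : ℝ => S.closedLoop (K + t • D))
      (W' := fun t : ℝ => S.closedLoopNoise (K + t • D)) ?_ ?_ ?_
    · simp only [closedLoop_add_smul]
      have hc : Continuous fun t : ℝ => S.closedLoop K + t • S.closedLoopDeriv D := by fun_prop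
      simpa [Function.comp_def] using (hc.tendsto 0).comp hid
    · simp only [closedLoopNoise_add_smul]
      have hc : Continuous fun t : ℝ => S.closedLoopNoise K + t • (S.closedLoopNoiseDeriv K D +
        t • fromBlocks 0 0 0 (D.BK * S.V * D.BKᵀ)) := by fun_prop
      simpa [Function.comp_def] using (hc.tendsto 0).comp hid
    · exact hev.mono fun t ht => hZ t ht
  let W₂ : Matrix (Fin n ⊕ Fin q) (Fin n ⊕ Fin q) ℝ := fromBlocks 0 0 0 (D.BK * S.V * D.BKᵀ)
  let Q₂ : Matrix (Fin n ⊕ Fin q) (Fin n ⊕ Fin q) ℝ := fromBlocks 0 0 0 (D.CKᵀ * S.R * D.CK)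
  -- `g (t, Z t)` is the difference quotient of the cost along D, with the factor t cancelled, so
  -- that it still makes sense at t = 0.
  let g : ℝ × Matrix (Fin n ⊕ Fin q) (Fin n ⊕ Fin q) ℝ → ℝ := fun a =>
    ((S.closedLoopWeightDeriv K D + a.1 • Q₂) * a.2).trace +
      (Y * (S.closedLoopDeriv D * a.2 * (S.closedLoop K)ᵀ +
        S.closedLoop K * a.2 * (S.closedLoopDeriv D)ᵀ +
        a.1 • (S.closedLoopDeriv D * a.2 * (S.closedLoopDeriv D)ᵀ))).trace +
      (Y * (S.closedLoopNoiseDeriv K D + a.1 • W₂)).trace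
  have hg : Continuous g := by fun_prop
  have hglim : Tendsto (fun t : ℝ => g (t, Z t)) (𝓝[≠] 0) (𝓝 (g (0, X))) :=
    (hg.tendsto (0, X)).comp (hid.prodMk_nhds hZlim)
  have hslope : Tendsto (fun t : ℝ => t⁻¹ • (S.cost N (K + t • D) - S.cost N K)) (𝓝[≠] 0)
      (𝓝 0) := by
    have h := hderiv.lim (l := 𝓝[≠] (0 : ℝ)) (c := fun t : ℝ => t⁻¹) (d := fun t : ℝ => t • D)
      (v := D) ?_ hev ?_
    · simpa using h
    · have hc : Continuous fun t : ℝ => t • D := by fun_prop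
      simpa [Function.comp_def] using (hc.tendsto 0).comp hid
    · refine tendsto_const_nhds.congr' ?_
      filter_upwards [self_mem_nhdsWithin] with t ht
      rw [smul_smul, inv_mul_cancel₀ ht, one_smul]
  have hEq : (fun t : ℝ => t⁻¹ • (S.cost N (K + t • D) - S.cost N K)) =ᶠ[𝓝[≠] 0]
      fun t : ℝ => g (t, Z t) := by
    filter_upwards [self_mem_nhdsWithin, hev] with t ht hmem'
    have h1 := trace_sub_trace_of_lyapunov (Q' := S.closedLoopWeight (K + t • D)) hX
      (hZ t hmem') hY
    rw [cost_eq N hmem' (hZ t hmem'), cost_eq N hmem hX, h1, closedLoop_add_smul,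
      closedLoopNoise_add_smul, closedLoopWeight_add_smul, add_sub_cancel_left,
      add_sub_cancel_left]
    have h2 : (S.closedLoop K + t • S.closedLoopDeriv D) * Z t *
        (S.closedLoop K + t • S.closedLoopDeriv D)ᵀ -
        S.closedLoop K * Z t * (S.closedLoop K)ᵀ =
        t • (S.closedLoopDeriv D * Z t * (S.closedLoop K)ᵀ +
          S.closedLoop K * Z t * (S.closedLoopDeriv D)ᵀ +
          t • (S.closedLoopDeriv D * Z t * (S.closedLoopDeriv D)ᵀ)) := by
      simp only [transpose_add, transpose_smul, Matrix.add_mul, Matrix.mul_add, Matrix.smul_mul,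
        Matrix.mul_smul, smul_add]
      abel
    rw [h2]
    simp only [Matrix.smul_mul, Matrix.mul_smul, trace_smul, smul_eq_mul, g, W₂, Q₂]
    have ht' : t ≠ 0 := ht
    field_simp
  have h0 := tendsto_nhds_unique (hslope.congr' hEq) hglim
  simpa [g] using h0.symm

/-- By symmetry of X and Y both mixed terms of the directional derivative equal the pairing of
`closedLoopDeriv` with X Fᵀ Y. Varying A_K, B_K and C_K separately gives the three equations by
nondegeneracy of the trace pairing. -/
theorem IsStationary.gradient_eq_zero (hK : S.IsStationary N K)
    (hX : X = S.closedLoop K * X * (S.closedLoop K)ᵀ + S.closedLoopNoise K)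
    (hY : Y = (S.closedLoop K)ᵀ * Y * S.closedLoop K + S.closedLoopWeight K)
    (hXt : Xᵀ = X) (hYt : Yᵀ = Y) :
    (X * (S.closedLoop K)ᵀ * Y).toBlocks₂₂ = 0 ∧
      S.C * (X * (S.closedLoop K)ᵀ * Y).toBlocks₁₂ + S.V * K.BKᵀ * Y.toBlocks₂₂ = 0 ∧
      (X * (S.closedLoop K)ᵀ * Y).toBlocks₂₁ * S.B + X.toBlocks₂₂ * K.CKᵀ * S.R = 0 := by
  set M := X * (S.closedLoop K)ᵀ * Y with hM
  have key : ∀ D : Controller m p q, (S.closedLoopWeightDeriv K D * X).trace +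
      2 * (S.closedLoopDeriv D * M).trace + (Y * S.closedLoopNoiseDeriv K D).trace = 0 := by
    intro D
    rw [← hK.trace_eq_zero hX hY D, Matrix.mul_add, trace_add]
    have h1 : (Y * (S.closedLoopDeriv D * X * (S.closedLoop K)ᵀ)).trace =
        (S.closedLoopDeriv D * M).trace := by
      rw [trace_mul_comm, hM]
      simp only [Matrix.mul_assoc]
    have h2 : (Y * (S.closedLoop K * X * (S.closedLoopDeriv D)ᵀ)).trace =
        (S.closedLoopDeriv D * M).trace := by
      rw [← trace_transpose, hM]
      simp only [transpose_mul, transpose_transpose, hXt, hYt, Matrix.mul_assoc]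
    rw [h1, h2]
    ring
  have hRt := S.posDef_R.transpose_eq
  have hVt := S.posDef_V.transpose_eq
  have hX22 : X.toBlocks₂₂ᵀ = X.toBlocks₂₂ := congrArg toBlocks₂₂ hXt
  have hY22 : Y.toBlocks₂₂ᵀ = Y.toBlocks₂₂ := congrArg toBlocks₂₂ hYt
  rw [← fromBlocks_toBlocks X, ← fromBlocks_toBlocks Y, ← fromBlocks_toBlocks M] at key
  simp only [closedLoopWeightDeriv, closedLoopDeriv, closedLoopNoiseDeriv, fromBlocks_multiply,
    trace_fromBlocks, Matrix.zero_mul, Matrix.mul_zero, zero_add, add_zero, trace_zero,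
    Controller.AK, Controller.BK, Controller.CK] at key
  refine ⟨?_, ?_, ?_⟩
  · refine ext_iff_trace_mul_left.2 fun D => ?_
    have h := key (D, 0, 0)
    simpa using h
  · refine ext_iff_trace_mul_left.2 fun D => ?_
    have h := key (0, D, 0)
    have h1 : (Y.toBlocks₂₂ * (D * S.V * K.BKᵀ)).trace =
        (D * (S.V * K.BKᵀ * Y.toBlocks₂₂)).trace := by
      rw [trace_mul_comm]
      simp only [Matrix.mul_assoc]
    have h2 : (Y.toBlocks₂₂ * (K.BK * S.V * Dᵀ)).trace =
        (D * (S.V * K.BKᵀ * Y.toBlocks₂₂)).trace := by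
      rw [← trace_transpose]
      simp only [transpose_mul, transpose_transpose, hVt, hY22, Matrix.mul_assoc]
    simp only [Controller.BK] at h1 h2 ⊢
    simp only [Matrix.mul_zero, Matrix.zero_mul, transpose_zero, trace_zero, Matrix.mul_add,
      trace_add, add_zero, zero_add, h1, h2] at h ⊢
    rw [← Matrix.mul_assoc D S.C]
    linarith
  · refine ext_iff_trace_mul_left.2 fun D => ?_
    have h := key (0, 0, D)
    have h1 : (K.CKᵀ * S.R * D * X.toBlocks₂₂).trace =
        (D * (X.toBlocks₂₂ * K.CKᵀ * S.R)).trace := by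
      rw [Matrix.mul_assoc, trace_mul_comm]
      simp only [Matrix.mul_assoc]
    have h2 : (Dᵀ * S.R * K.CK * X.toBlocks₂₂).trace =
        (D * (X.toBlocks₂₂ * K.CKᵀ * S.R)).trace := by
      rw [← trace_transpose, ← h1]
      simp only [transpose_mul, transpose_transpose, hRt, hX22, Matrix.mul_assoc]
      rw [trace_mul_comm]
      simp only [Matrix.mul_assoc]
    have h3 : (S.B * D * M.toBlocks₂₁).trace = (D * (M.toBlocks₂₁ * S.B)).trace := by
      rw [Matrix.mul_assoc, trace_mul_comm]
      simp only [Matrix.mul_assoc]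
    simp only [Controller.CK] at h1 h2 ⊢
    simp only [Matrix.mul_zero, Matrix.zero_mul, transpose_zero, trace_zero, Matrix.mul_add,
      Matrix.add_mul, trace_add, add_zero, h1, h2, h3] at h ⊢
    linarith

end Stationary

end LQGSystem

/-! ### Duality of estimation and control; definiteness of the Gramians -/

namespace LQGSystem

variable {n m p q : ℕ}

/-- The dual LQG problem, in which estimation and control are exchanged. -/
def dual (S : LQGSystem n m p) : LQGSystem n p m where
  A := S.Aᵀ
  B := S.Cᵀ
  C := S.Bᵀ
  W := S.Q
  V := S.R
  Q := S.W
  R := S.V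
  posSemidef_W := S.posSemidef_Q
  posDef_V := S.posDef_R
  posSemidef_Q := S.posSemidef_W
  posDef_R := S.posDef_V

/-- The dual controller. -/
def dualController (K : Controller m p q) : Controller p m q := (K.AKᵀ, K.CKᵀ, K.BKᵀ)

variable {S : LQGSystem n m p} {K : Controller m p q}

theorem closedLoop_dual : S.dual.closedLoop (dualController K) = (S.closedLoop K)ᵀ := by
  simp [closedLoop, dual, dualController, fromBlocks_transpose]

theorem closedLoopNoise_dual :
    S.dual.closedLoopNoise (dualController K) = S.closedLoopWeight K := by
  simp [closedLoopNoise, closedLoopWeight, dual, dualController, Controller.BK, Controller.CK]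

theorem closedLoopWeight_dual :
    S.dual.closedLoopWeight (dualController K) = S.closedLoopNoise K := by
  simp [closedLoopNoise, closedLoopWeight, dual, dualController, Controller.BK, Controller.CK]

theorem filterRiccati_iff_dual {P : Matrix (Fin n) (Fin n) ℝ} :
    S.FilterRiccati P ↔ S.dual.ControlRiccati P := by
  simp [FilterRiccati, ControlRiccati, dual]

theorem controlRiccati_iff_dual {Y : Matrix (Fin n) (Fin n) ℝ} :
    S.ControlRiccati Y ↔ S.dual.FilterRiccati Y := by
  simp [FilterRiccati, ControlRiccati, dual]

theorem feedbackGain_dual {P : Matrix (Fin n) (Fin n) ℝ} (hP : Pᵀ = P) :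
    S.dual.feedbackGain P = (S.kalmanGain P)ᵀ := by
  simp [feedbackGain, kalmanGain, dual, hP, transpose_nonsing_inv, S.posDef_V.transpose_eq,
    Matrix.mul_assoc]

theorem kalmanGain_dual {Y : Matrix (Fin n) (Fin n) ℝ} (hY : Yᵀ = Y) :
    S.dual.kalmanGain Y = (S.feedbackGain Y)ᵀ := by
  simp [feedbackGain, kalmanGain, dual, hY, transpose_nonsing_inv, S.posDef_R.transpose_eq,
    Matrix.mul_assoc]

/-- The innovation covariance `C P Cᵀ + V`. -/
def innovationCov (S : LQGSystem n m p) (P : Matrix (Fin n) (Fin n) ℝ) :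
    Matrix (Fin p) (Fin p) ℝ :=
  S.C * P * S.Cᵀ + S.V

theorem inputWeight_dual {P : Matrix (Fin n) (Fin n) ℝ} :
    S.dual.inputWeight P = S.innovationCov P := by
  simp [inputWeight, innovationCov, dual]

theorem posDef_innovationCov {P : Matrix (Fin n) (Fin n) ℝ} (hP : P.PosSemidef) :
    (S.innovationCov P).PosDef := by
  rw [← inputWeight_dual]
  exact posDef_inputWeight hP

theorem kalmanGain_mul_innovationCov {P : Matrix (Fin n) (Fin n) ℝ} (hP : P.PosSemidef) :
    S.kalmanGain P * S.innovationCov P = S.A * P * S.Cᵀ := by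
  have h := feedbackGain_transpose_mul (S := S.dual) hP
  rw [feedbackGain_dual hP.transpose_eq, inputWeight_dual, transpose_transpose] at h
  simpa [dual] using h

/-- If z is in the kernel of X₂₂, the Lyapunov equation tested on (0, z) gives B_Kᵀ z = 0, since V ≻
0. Then Fᵀ(0, z) = (0, A_Kᵀ z), so the kernel is A_Kᵀ-invariant and controllability makes it
trivial. -/
theorem posDef_toBlocks₂₂_of_controllable {X : Matrix (Fin n ⊕ Fin q) (Fin n ⊕ Fin q) ℝ}
    (hK : IsControllablePair K.AK K.BK) (hXp : X.PosSemidef)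
    (hX : X = S.closedLoop K * X * (S.closedLoop K)ᵀ + S.closedLoopNoise K) :
    X.toBlocks₂₂.PosDef := by
  have hquad : ∀ z : Fin q → ℝ, z ⬝ᵥ (X.toBlocks₂₂ *ᵥ z) =
      Sum.elim (0 : Fin n → ℝ) z ⬝ᵥ (X *ᵥ Sum.elim 0 z) := by
    intro z
    conv_rhs => rw [← fromBlocks_toBlocks X]
    simp [fromBlocks_mulVec]
  have key : ∀ z : Fin q → ℝ, z ⬝ᵥ (X.toBlocks₂₂ *ᵥ z) = 0 →
      K.BKᵀ *ᵥ z = 0 ∧ (K.AKᵀ *ᵥ z) ⬝ᵥ (X.toBlocks₂₂ *ᵥ (K.AKᵀ *ᵥ z)) = 0 := by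
    intro z hz
    have h1 : z ⬝ᵥ (X.toBlocks₂₂ *ᵥ z) =
        ((S.closedLoop K)ᵀ *ᵥ Sum.elim 0 z) ⬝ᵥ (X *ᵥ ((S.closedLoop K)ᵀ *ᵥ Sum.elim 0 z)) +
          (K.BKᵀ *ᵥ z) ⬝ᵥ (S.V *ᵥ (K.BKᵀ *ᵥ z)) := by
      rw [hquad, ← dotProduct_transpose_mul_mul_mulVec, ← dotProduct_transpose_mul_mul_mulVec,
        transpose_transpose, transpose_transpose]
      conv_lhs => rw [hX]
      simp [add_mulVec, closedLoopNoise, fromBlocks_mulVec]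
    have h2 := hXp.dotProduct_nonneg ((S.closedLoop K)ᵀ *ᵥ Sum.elim 0 z)
    have h3 := S.posDef_V.posSemidef.dotProduct_nonneg (K.BKᵀ *ᵥ z)
    have h4 : K.BKᵀ *ᵥ z = 0 := S.posDef_V.eq_zero_of_dotProduct_mulVec (by linarith)
    refine ⟨h4, ?_⟩
    have h5 : (S.closedLoop K)ᵀ *ᵥ Sum.elim 0 z =
        Sum.elim (0 : Fin n → ℝ) (K.AKᵀ *ᵥ z) := by
      simp [closedLoop, fromBlocks_transpose, fromBlocks_mulVec, ← mulVec_mulVec, h4]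
    rw [hquad, ← h5]
    linarith
  have h22 : X.toBlocks₂₂.PosSemidef := hXp.submatrix Sum.inr
  refine .of_dotProduct_mulVec_pos h22.1 fun {z} hz => ?_
  rw [star_trivial]
  refine lt_of_le_of_ne (h22.dotProduct_nonneg z) fun h0 => hz ?_
  exact (isControllablePair_iff_transpose.1 hK).eq_zero_of_invariant
    (fun z => z ⬝ᵥ (X.toBlocks₂₂ *ᵥ z) = 0) (fun z hz => (key z hz).2) (fun z hz => (key z hz).1)
    h0.symm

end LQGSystem

/-! ### Schur complement coordinates -/

namespace Matrix

/-- The block matrix `[P, 0; 0, 0] + [H; 1] X [Hᵀ, 1]`, with Schur complement `P`. -/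
def schurBlocks {ι κ : Type*} [Fintype κ] (P : Matrix ι ι ℝ) (H : Matrix ι κ ℝ)
    (X : Matrix κ κ ℝ) : Matrix (ι ⊕ κ) (ι ⊕ κ) ℝ :=
  fromBlocks (P + H * X * Hᵀ) (H * X) (X * Hᵀ) X

variable {ι κ : Type*} [Fintype ι] [DecidableEq ι] [Fintype κ] [DecidableEq κ]

/-- H = X₁₂ X₂₂⁻¹, and P is the compression [1, -H] X [1, -H]ᵀ, hence positive semidefinite. -/
theorem exists_eq_schurBlocks {X : Matrix (ι ⊕ κ) (ι ⊕ κ) ℝ} (hX : X.PosSemidef)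
    (h22 : X.toBlocks₂₂.PosDef) :
    ∃ (P : Matrix ι ι ℝ) (H : Matrix ι κ ℝ), P.PosSemidef ∧
      X = schurBlocks P H X.toBlocks₂₂ := by
  have hu : IsUnit X.toBlocks₂₂.det := (isUnit_iff_isUnit_det _).1 h22.isUnit
  have h21 : X.toBlocks₂₁ = X.toBlocks₁₂ᵀ := (congrArg toBlocks₂₁ hX.transpose_eq).symm
  set D := X.toBlocks₂₂ with hD
  set H := X.toBlocks₁₂ * D⁻¹ with hH
  have h1 : H * D = X.toBlocks₁₂ := by rw [hH, Matrix.mul_assoc, nonsing_inv_mul _ hu, Matrix.mul_one]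
  have h2 : D * Hᵀ = X.toBlocks₂₁ := by
    have h := congrArg transpose h1
    rw [transpose_mul, h22.transpose_eq] at h
    exact h.trans h21.symm
  refine ⟨X.toBlocks₁₁ - H * D * Hᵀ, H, ?_, ?_⟩
  · have h3 := hX.mul_mul_transpose (fromCols (1 : Matrix ι ι ℝ) (-H))
    convert h3 using 1
    conv_rhs => rw [← fromBlocks_toBlocks X, ← h1, ← h2, ← hD]
    rw [fromCols_mul_fromBlocks, transpose_fromCols, fromCols_mul_fromRows]
    simp [Matrix.mul_assoc]
    abel
  · conv_lhs => rw [← fromBlocks_toBlocks X, ← h1, ← h2, ← hD]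
    simp [schurBlocks]

theorem eq_zero_of_mul_mul_eq_zero {D : Matrix ι ι ℝ} {E : Matrix κ κ ℝ} (hD : IsUnit D)
    (hE : IsUnit E) {M : Matrix ι κ ℝ} (h : D * M * E = 0) : M = 0 := by
  have h1 := congrArg (fun Z => D⁻¹ * Z * E⁻¹) h
  simpa [Matrix.mul_assoc, nonsing_inv_mul_cancel_left, mul_nonsing_inv _
    ((isUnit_iff_isUnit_det _).1 hE), nonsing_inv_mul_cancel_left _ _
    ((isUnit_iff_isUnit_det _).1 hD)] using h1

end Matrix

/-! ### From stationarity to the Riccati equations -/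

namespace LQGSystem

variable {n m p q : ℕ} {S : LQGSystem n m p} {K : Controller m p q}
  {P Y : Matrix (Fin n) (Fin n) ℝ} {H : Matrix (Fin n) (Fin q) ℝ}
  {X₂ Y₂ : Matrix (Fin q) (Fin q) ℝ} {Γ : Matrix (Fin q) (Fin n) ℝ}

theorem closedLoop_mul_schurBlocks :
    S.closedLoop K * schurBlocks P H X₂ =
      fromBlocks (S.A * P + (S.A * H + S.B * K.CK) * X₂ * Hᵀ) ((S.A * H + S.B * K.CK) * X₂)
        (K.BK * S.C * P + (K.BK * S.C * H + K.AK) * X₂ * Hᵀ)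
        ((K.BK * S.C * H + K.AK) * X₂) := by
  rw [closedLoop, schurBlocks, fromBlocks_multiply]
  congr 1 <;> simp only [Matrix.mul_add, Matrix.add_mul, Matrix.mul_assoc] <;> abel

/-- The stationarity conditions, in terms of the Schur complements and gains of the two Gramians. -/
theorem stationarity_schur (hX₂ : X₂.PosDef) (hY₂ : Y₂.PosDef) (hP : P.PosSemidef)
    (hY : Y.PosSemidef)
    {M : Matrix (Fin n ⊕ Fin q) (Fin n ⊕ Fin q) ℝ}
    (hM : M = schurBlocks P H X₂ * (S.closedLoop K)ᵀ * schurBlocks Y (-Γᵀ) Y₂)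
    (h₁ : M.toBlocks₂₂ = 0) (h₂ : S.C * M.toBlocks₁₂ + S.V * K.BKᵀ * Y₂ = 0)
    (h₃ : M.toBlocks₂₁ * S.B + X₂ * K.CKᵀ * S.R = 0) :
    K.BK * S.C * H + K.AK = Γ * (S.A * H + S.B * K.CK) ∧
      K.BK * S.innovationCov P = Γ * (S.A * P * S.Cᵀ) ∧
      S.inputWeight Y * K.CK = -(S.Bᵀ * Y * S.A * H) := by
  have hXt : (schurBlocks P H X₂)ᵀ = schurBlocks P H X₂ := by
    simp [schurBlocks, fromBlocks_transpose, hX₂.transpose_eq, hP.transpose_eq, Matrix.mul_assoc]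
  have hYt : (schurBlocks Y (-Γᵀ) Y₂)ᵀ = schurBlocks Y (-Γᵀ) Y₂ := by
    simp [schurBlocks, fromBlocks_transpose, hY₂.transpose_eq, hY.transpose_eq, Matrix.mul_assoc]
  set Z := S.A * H + S.B * K.CK with hZ
  set E := K.BK * S.C * H + K.AK with hE
  have hG : Mᵀ = fromBlocks (Y + Γᵀ * Y₂ * Γ) (-(Γᵀ * Y₂)) (-(Y₂ * Γ)) Y₂ *
      fromBlocks (S.A * P + Z * X₂ * Hᵀ) (Z * X₂) (K.BK * S.C * P + E * X₂ * Hᵀ) (E * X₂) := by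
    rw [hM, transpose_mul, transpose_mul, transpose_transpose, hXt, hYt,
      closedLoop_mul_schurBlocks]
    simp [schurBlocks, hZ, hE]
  rw [fromBlocks_multiply] at hG
  have g22 : M.toBlocks₂₂ᵀ = -(Y₂ * Γ) * (Z * X₂) + Y₂ * (E * X₂) := congrArg toBlocks₂₂ hG
  have g12 : M.toBlocks₁₂ᵀ = -(Y₂ * Γ) * (S.A * P + Z * X₂ * Hᵀ) +
      Y₂ * (K.BK * S.C * P + E * X₂ * Hᵀ) := congrArg toBlocks₂₁ hG
  have g21 : M.toBlocks₂₁ᵀ = (Y + Γᵀ * Y₂ * Γ) * (Z * X₂) + -(Γᵀ * Y₂) * (E * X₂) :=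
    congrArg toBlocks₁₂ hG
  -- The vanishing block is Y₂ (E - Γ Z) X₂. Once E = Γ Z, the other two equations lose their
  -- remaining cross terms, and Y₂ or X₂ can be cancelled.
  have hEZ : E = Γ * Z := by
    refine sub_eq_zero.1 (eq_zero_of_mul_mul_eq_zero hY₂.isUnit hX₂.isUnit ?_)
    rw [h₁, transpose_zero] at g22
    rw [g22]
    simp only [Matrix.mul_sub, Matrix.sub_mul, Matrix.neg_mul, Matrix.mul_assoc]
    abel
  refine ⟨hEZ, ?_, ?_⟩
  · have h := congrArg transpose h₂
    rw [transpose_add, transpose_mul, g12, hEZ, transpose_mul, transpose_mul, transpose_transpose,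
      S.posDef_V.transpose_eq, hY₂.transpose_eq, transpose_zero] at h
    refine sub_eq_zero.1 (eq_zero_of_mul_mul_eq_zero hY₂.isUnit isUnit_one ?_)
    rw [← h, innovationCov]
    simp only [Matrix.mul_sub, Matrix.mul_add, Matrix.add_mul, Matrix.neg_mul,
      Matrix.mul_assoc, Matrix.mul_one]
    abel
  · have h := congrArg transpose h₃
    rw [transpose_add, transpose_mul, g21, hEZ, transpose_mul, transpose_mul, transpose_transpose,
      S.posDef_R.transpose_eq, hX₂.transpose_eq, transpose_zero] at h
    refine eq_neg_of_add_eq_zero_left (eq_zero_of_mul_mul_eq_zero isUnit_one hX₂.isUnit ?_)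
    rw [← h, inputWeight, hZ]
    simp only [Matrix.mul_add, Matrix.add_mul, Matrix.neg_mul, Matrix.mul_neg,
      Matrix.mul_assoc, Matrix.one_mul]
    abel

/-- Under the stationarity relations the (2,2) block of the Lyapunov equation is Γ times the (1,2)
block, that is X₂ = Γ H X₂. If also H Γ = 1, the (1,2) block times Hᵀ expresses H X₂ Hᵀ, and
subtracting it from the (1,1) block leaves the Riccati equation. -/
theorem filterRiccati_of_schur (hX₂ : X₂.PosDef) (hP : P.PosSemidef)
    (hX : schurBlocks P H X₂ = S.closedLoop K * schurBlocks P H X₂ * (S.closedLoop K)ᵀ +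
      S.closedLoopNoise K)
    (hE : K.BK * S.C * H + K.AK = Γ * (S.A * H + S.B * K.CK))
    (hB : K.BK * S.innovationCov P = Γ * (S.A * P * S.Cᵀ)) :
    Γ * H = 1 ∧ K.BK = Γ * S.kalmanGain P ∧ (H * Γ = 1 → S.FilterRiccati P) := by
  have hMu : IsUnit (S.innovationCov P).det :=
    (isUnit_iff_isUnit_det _).1 (posDef_innovationCov hP).isUnit
  have hBL : K.BK = Γ * S.kalmanGain P := by
    rw [← kalmanGain_mul_innovationCov hP, ← Matrix.mul_assoc] at hB
    have h := congrArg (· * (S.innovationCov P)⁻¹) hB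
    simpa only [mul_nonsing_inv_cancel_right _ _ hMu] using h
  set Z := S.A * H + S.B * K.CK with hZ
  rw [closedLoop_mul_schurBlocks, hE, ← hZ, closedLoop, fromBlocks_transpose,
    fromBlocks_multiply, closedLoopNoise, fromBlocks_add, schurBlocks] at hX
  obtain ⟨h11, h12, -, h22⟩ := fromBlocks_inj.1 hX
  have hZt : Hᵀ * S.Aᵀ + (S.B * K.CK)ᵀ = Zᵀ := by rw [hZ, transpose_add, transpose_mul S.A]
  have hEt : Hᵀ * (K.BK * S.C)ᵀ + K.AKᵀ = Zᵀ * Γᵀ := by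
    rw [← transpose_mul Γ Z, ← hE, transpose_add, transpose_mul (K.BK * S.C)]
  have e11 : P + H * X₂ * Hᵀ = S.A * P * S.Aᵀ + Z * X₂ * Zᵀ + S.W := by
    rw [h11, ← hZt]
    simp only [Matrix.mul_add, Matrix.add_mul, Matrix.mul_assoc]
    abel
  have e12 : H * X₂ = S.A * P * S.Cᵀ * K.BKᵀ + Z * X₂ * (Zᵀ * Γᵀ) := by
    rw [h12, ← hEt]
    simp only [transpose_mul, Matrix.mul_add, Matrix.add_mul, Matrix.mul_assoc]
    abel
  have e22 : X₂ = K.BK * S.innovationCov P * K.BKᵀ + Γ * Z * X₂ * (Zᵀ * Γᵀ) := by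
    conv_lhs => rw [h22]
    rw [← hEt, innovationCov]
    simp only [transpose_mul, Matrix.mul_add, Matrix.add_mul, Matrix.mul_assoc]
    abel
  have hΓH : Γ * H = 1 := by
    have h : X₂ = Γ * (H * X₂) := by
      conv_lhs => rw [e22, hB]
      rw [e12]
      simp only [Matrix.mul_add, Matrix.mul_assoc]
    refine (sub_eq_zero.1 (eq_zero_of_mul_mul_eq_zero isUnit_one hX₂.isUnit (M := 1 - Γ * H)
      ?_)).symm
    rw [Matrix.one_mul, Matrix.sub_mul, Matrix.one_mul, Matrix.mul_assoc, ← h, sub_self]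
  refine ⟨hΓH, hBL, fun hHΓ => ?_⟩
  have hΓHt : Γᵀ * Hᵀ = 1 := by rw [← transpose_mul, hHΓ, transpose_one]
  have e3 : H * X₂ * Hᵀ = S.A * P * S.Cᵀ * (S.kalmanGain P)ᵀ + Z * X₂ * Zᵀ := by
    rw [e12, hBL, transpose_mul, Matrix.add_mul]
    simp only [Matrix.mul_assoc, hΓHt, Matrix.mul_one]
  have e4 : S.A * P * S.Cᵀ * (S.kalmanGain P)ᵀ =
      S.A * P * S.Cᵀ * (S.C * P * S.Cᵀ + S.V)⁻¹ * S.C * P * S.Aᵀ := by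
    have hMt : (S.C * P * S.Cᵀ + S.V)ᵀ = S.C * P * S.Cᵀ + S.V :=
      (posDef_innovationCov (S := S) hP).transpose_eq
    rw [kalmanGain, transpose_mul, transpose_nonsing_inv, hMt]
    simp only [transpose_mul, transpose_transpose, hP.transpose_eq, Matrix.mul_assoc]
  rw [FilterRiccati, ← e4]
  rw [e3] at e11
  exact (eq_sub_of_add_eq e11).trans (by abel)

end LQGSystem

/-! ### The lower bound on the cost -/

namespace LQGSystem

variable {n m p q : ℕ} {S : LQGSystem n m p} {K : Controller m p q}
  {P Y : Matrix (Fin n) (Fin n) ℝ}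

/-- diag(Y, 0) solves the dual Lyapunov equation up to a square in [K, C_K], which maps (x, ξ) to
the deviation u + K x from the optimal state feedback. -/
theorem riccati_residual (hY : Y.PosSemidef) (hYR : S.ControlRiccati Y) :
    (S.closedLoop K)ᵀ * fromBlocks Y 0 0 0 * S.closedLoop K + S.closedLoopWeight K =
      fromBlocks Y 0 0 0 +
        (fromCols (S.feedbackGain Y) K.CK)ᵀ * S.inputWeight Y *
          fromCols (S.feedbackGain Y) K.CK := by
  have h1 := feedbackGain_transpose_mul (S := S) hY
  have h2 := inputWeight_mul_feedbackGain (S := S) hY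
  have hR : Y = S.Aᵀ * Y * S.A - S.Aᵀ * Y * S.B * S.feedbackGain Y + S.Q :=
    Eq.trans hYR riccatiStep_eq
  rw [closedLoop, closedLoopWeight, fromBlocks_transpose, fromBlocks_multiply,
    fromBlocks_multiply, fromBlocks_add, transpose_fromCols, fromRows_mul, fromRows_mul_fromCols,
    fromBlocks_add, fromBlocks_inj, h1]
  refine ⟨?_, ?_, ?_, ?_⟩
  · simp only [Matrix.mul_zero, Matrix.zero_mul, add_zero]
    rw [← sub_eq_zero, ← neg_eq_zero, ← sub_eq_zero.2 hR]
    abel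
  · simp [Matrix.mul_assoc]
  · simp only [Matrix.mul_zero, Matrix.zero_mul, add_zero, zero_add, Matrix.mul_assoc, h2]
    simp [Matrix.mul_assoc]
  · simp only [Matrix.mul_zero, Matrix.zero_mul, add_zero, zero_add, inputWeight,
      Matrix.mul_add, Matrix.add_mul, transpose_mul, Matrix.mul_assoc]

theorem trace_closedLoopWeight_mul (hY : Y.PosSemidef) (hYR : S.ControlRiccati Y)
    (X : Matrix (Fin n ⊕ Fin q) (Fin n ⊕ Fin q) ℝ)
    (hX : X = S.closedLoop K * X * (S.closedLoop K)ᵀ + S.closedLoopNoise K) :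
    (S.closedLoopWeight K * X).trace = (Y * S.W).trace +
      (S.inputWeight Y * (fromCols (S.feedbackGain Y) K.CK * X *
        (fromCols (S.feedbackGain Y) K.CK)ᵀ)).trace := by
  set Θ := fromCols (S.feedbackGain Y) K.CK with hΘ
  set Ye : Matrix (Fin n ⊕ Fin q) (Fin n ⊕ Fin q) ℝ := fromBlocks Y 0 0 0 with hYe
  have hres : Ye = (S.closedLoop K)ᵀ * Ye * S.closedLoop K +
      (S.closedLoopWeight K - Θᵀ * S.inputWeight Y * Θ) := by
    rw [← add_sub_assoc, riccati_residual hY hYR, ← hΘ, add_sub_cancel_right]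
  have h1 := trace_mul_eq_of_lyapunov hres X
  have h2 : X - S.closedLoop K * X * (S.closedLoop K)ᵀ = S.closedLoopNoise K := by
    rw [sub_eq_iff_eq_add']; exact hX
  rw [h2, Matrix.sub_mul, trace_sub, sub_eq_iff_eq_add] at h1
  rw [h1, hYe, closedLoopNoise, fromBlocks_multiply, trace_fromBlocks, Matrix.mul_assoc Θᵀ,
    Matrix.mul_assoc Θᵀ, trace_mul_comm Θᵀ]
  simp only [Matrix.mul_zero, Matrix.zero_mul, add_zero, trace_zero, Matrix.mul_assoc]

/-- By the dual of `riccati_residual`, the difference solves a Lyapunov equation with positive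
semidefinite forcing. -/
theorem posSemidef_sub_filter (hP : P.PosSemidef) (hPR : S.FilterRiccati P)
    (hK : K ∈ S.stabilizing q) {X : Matrix (Fin n ⊕ Fin q) (Fin n ⊕ Fin q) ℝ}
    (hX : X = S.closedLoop K * X * (S.closedLoop K)ᵀ + S.closedLoopNoise K) :
    (X - fromBlocks P 0 0 0).PosSemidef := by
  have hres := riccati_residual (K := dualController K) hP (filterRiccati_iff_dual.1 hPR)
  rw [closedLoop_dual, closedLoopWeight_dual, transpose_transpose] at hres
  have hW := (posDef_inputWeight (S := S.dual) hP).posSemidef.transpose_mul_mul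
    (fromCols (S.dual.feedbackGain P) (dualController K).CK)
  refine (mem_stabilizing_iff.1 hK).posSemidef_lyapunov hW ?_
  rw [← sub_eq_iff_eq_add'] at hres
  rw [← hres]
  conv_lhs => rw [hX]
  rw [Matrix.mul_sub, Matrix.sub_mul]
  abel

theorem _root_.Matrix.PosSemidef.trace_mul_nonneg {k : ℕ} {M D : Matrix (Fin k) (Fin k) ℝ}
    (hM : M.PosSemidef) (hD : D.PosSemidef) : 0 ≤ (M * D).trace := by
  obtain ⟨h1, h2⟩ := matrixSqrt_spec hM
  have h3 := (hD.transpose_mul_mul (matrixSqrt M)).trace_nonneg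
  rwa [trace_mul_comm, h1.transpose_eq, ← Matrix.mul_assoc, h2] at h3

variable {Ω : Type*} [MeasurableSpace Ω] {μ : Measure Ω} [IsProbabilityMeasure μ]
  {N : S.RandomInputs q μ}

/-- P is arbitrary here: diag(P, 0) is merely subtracted from X and added back. -/
theorem cost_eq_of_riccati (hY : Y.PosSemidef) (hYR : S.ControlRiccati Y)
    (hK : K ∈ S.stabilizing q) {X : Matrix (Fin n ⊕ Fin q) (Fin n ⊕ Fin q) ℝ}
    (hX : X = S.closedLoop K * X * (S.closedLoop K)ᵀ + S.closedLoopNoise K) :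
    S.cost N K = (Y * S.W).trace +
      (S.inputWeight Y * (S.feedbackGain Y * P * (S.feedbackGain Y)ᵀ)).trace +
      (S.inputWeight Y * (fromCols (S.feedbackGain Y) K.CK * (X - fromBlocks P 0 0 0) *
        (fromCols (S.feedbackGain Y) K.CK)ᵀ)).trace := by
  have h1 : fromCols (S.feedbackGain Y) K.CK *
      (fromBlocks P 0 0 0 : Matrix (Fin n ⊕ Fin q) (Fin n ⊕ Fin q) ℝ) *
      (fromCols (S.feedbackGain Y) K.CK)ᵀ = S.feedbackGain Y * P * (S.feedbackGain Y)ᵀ := by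
    rw [fromCols_mul_fromBlocks, transpose_fromCols, fromCols_mul_fromRows]
    simp
  rw [cost_eq N hK hX, trace_closedLoopWeight_mul hY hYR X hX, ← h1, add_assoc, ← trace_add,
    ← Matrix.mul_add, ← Matrix.add_mul, ← Matrix.mul_add, add_sub_cancel]

/-- No stabilizing controller does better than the value given by the Riccati equations. -/
theorem le_cost (hP : P.PosSemidef) (hPR : S.FilterRiccati P) (hY : Y.PosSemidef)
    (hYR : S.ControlRiccati Y) (hK : K ∈ S.stabilizing q) :
    (Y * S.W).trace +
      (S.inputWeight Y * (S.feedbackGain Y * P * (S.feedbackGain Y)ᵀ)).trace ≤ S.cost N K := by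
  obtain ⟨X, hX⟩ := (mem_stabilizing_iff.1 hK).exists_lyapunov (S.closedLoopNoise K)
  rw [cost_eq_of_riccati (P := P) hY hYR hK hX]
  exact le_add_of_nonneg_right ((posDef_inputWeight hY).posSemidef.trace_mul_nonneg
    ((posSemidef_sub_filter hP hPR hK hX).mul_mul_transpose _))

theorem exists_posDef_controlRiccati (hAB : IsControllablePair S.A S.B)
    (hQ : IsObservablePair (matrixSqrt S.Q) S.A) :
    ∃ Y : Matrix (Fin n) (Fin n) ℝ, Y.PosDef ∧ S.ControlRiccati Y ∧
      ∀ Y', Y'.PosSemidef → S.ControlRiccati Y' → Y' = Y := by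
  obtain ⟨Y, hY, hYR⟩ := exists_posSemidef_controlRiccati hAB
  exact ⟨Y, hYR.posDef hY hQ, hYR, fun Y' hY' hYR' => hYR.unique hYR' hY hY' hQ⟩

theorem exists_posDef_filterRiccati (hCA : IsObservablePair S.C S.A)
    (hW : IsControllablePair S.A (matrixSqrt S.W)) :
    ∃ P : Matrix (Fin n) (Fin n) ℝ, P.PosDef ∧ S.FilterRiccati P ∧
      ∀ P', P'.PosSemidef → S.FilterRiccati P' → P' = P := by
  simp only [filterRiccati_iff_dual]
  refine exists_posDef_controlRiccati (isObservablePair_iff_transpose.1 hCA) ?_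
  have h := isControllablePair_iff_transpose.1 hW
  rwa [(matrixSqrt_spec S.posSemidef_W).1.transpose_eq] at h

theorem posSemidef_closedLoopNoise : (S.closedLoopNoise K).PosSemidef := by
  rw [← noiseInput_mul_noiseCov]
  refine PosSemidef.mul_mul_transpose ?_ _
  refine posSemidef_of_dotProduct_mulVec_nonneg ?_ fun x => ?_
  · simp [noiseCov, fromBlocks_transpose, S.posSemidef_W.transpose_eq, S.posDef_V.transpose_eq]
  · rw [← Sum.elim_comp_inl_inr x]
    simp only [noiseCov, fromBlocks_mulVec, sumElim_dotProduct_sumElim, Sum.elim_comp_inl,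
      Sum.elim_comp_inr, zero_mulVec, add_zero, zero_add]
    exact add_nonneg (S.posSemidef_W.dotProduct_nonneg _)
      (S.posDef_V.posSemidef.dotProduct_nonneg _)

theorem dual_mem_stabilizing (hK : K ∈ S.stabilizing q) :
    dualController K ∈ S.dual.stabilizing q := by
  rw [mem_stabilizing_iff, closedLoop_dual]
  exact (mem_stabilizing_iff.1 hK).transpose

end LQGSystem

/-! ### Minimal stationary points are optimal -/

namespace LQGSystem

/-- The structure of a minimal stationary point. -/
theorem IsStationary.exists_gain_form {n m p : ℕ} {S : LQGSystem n m p} {K : Controller m p n}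
    {Ω : Type*} [MeasurableSpace Ω] {μ : Measure Ω} [IsProbabilityMeasure μ]
    {N : S.RandomInputs n μ} (hK : S.IsStationary N K) (hmin : K.IsMinimal) :
    ∃ P Y H Γ X₂ : Matrix (Fin n) (Fin n) ℝ, P.PosSemidef ∧ Y.PosSemidef ∧ S.FilterRiccati P ∧
      S.ControlRiccati Y ∧ Γ * H = 1 ∧
      schurBlocks P H X₂ = S.closedLoop K * schurBlocks P H X₂ * (S.closedLoop K)ᵀ +
        S.closedLoopNoise K ∧
      K.BK = Γ * S.kalmanGain P ∧ K.CK = -(S.feedbackGain Y * H) ∧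
      K.BK * S.C * H + K.AK = Γ * (S.A * H + S.B * K.CK) := by
  have hF := mem_stabilizing_iff.1 hK.1
  obtain ⟨X, hX⟩ := hF.exists_lyapunov (S.closedLoopNoise K)
  have hXp := hF.posSemidef_lyapunov posSemidef_closedLoopNoise hX
  have hFd := mem_stabilizing_iff.1 (dual_mem_stabilizing hK.1)
  obtain ⟨Z, hZ⟩ := hFd.exists_lyapunov (S.dual.closedLoopNoise (dualController K))
  have hZp := hFd.posSemidef_lyapunov posSemidef_closedLoopNoise hZ
  have hX₂ := posDef_toBlocks₂₂_of_controllable hmin.1 hXp hX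
  have hZ₂ := posDef_toBlocks₂₂_of_controllable (S := S.dual) (K := dualController K)
    (isObservablePair_iff_transpose.1 hmin.2) hZp hZ
  obtain ⟨P, H, hP, hXs⟩ := exists_eq_schurBlocks hXp hX₂
  obtain ⟨Y, H', hY, hZs⟩ := exists_eq_schurBlocks hZp hZ₂
  obtain ⟨Γ, rfl⟩ : ∃ Γ : Matrix (Fin n) (Fin n) ℝ, H' = -Γᵀ := ⟨-H'ᵀ, by simp⟩
  have hZ' : Z = (S.closedLoop K)ᵀ * Z * S.closedLoop K + S.closedLoopWeight K := by
    simpa [closedLoop_dual, closedLoopNoise_dual] using hZ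
  obtain ⟨g₁, g₂, g₃⟩ := hK.gradient_eq_zero hX hZ' hXp.transpose_eq hZp.transpose_eq
  obtain ⟨hE, hB, hC⟩ := stationarity_schur (S := S) (K := K) hX₂ hZ₂ hP hY
    (M := X * (S.closedLoop K)ᵀ * Z) (by rw [← hXs, ← hZs]) g₁ g₂ g₃
  rw [hXs] at hX
  rw [hZs] at hZ
  obtain ⟨hΓH, hBK, hPR⟩ := filterRiccati_of_schur hX₂ hP hX hE hB
  -- Full order enters here: a one-sided inverse of a square matrix is two-sided.
  have hHΓ : H * Γ = 1 := mul_eq_one_comm.1 hΓH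
  -- Under duality (H, Γ) becomes (-Γᵀ, -Hᵀ), and the transposed stationarity relations are those of
  -- the dual problem.
  obtain ⟨-, hCK, hYR⟩ := filterRiccati_of_schur (S := S.dual) (K := dualController K) (Γ := -Hᵀ)
    hZ₂ hY hZ
    (by
      have h := congrArg transpose hE
      simp only [transpose_add, transpose_mul, Matrix.mul_assoc] at h
      simp only [dual, dualController, Matrix.mul_neg, Matrix.neg_mul, Matrix.mul_add,
        Matrix.mul_assoc]
      rw [← sub_eq_zero, ← sub_eq_zero.2 h]
      simp only [Matrix.add_mul, Matrix.mul_assoc]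
      abel)
    (by
      have h := congrArg transpose hC
      rw [transpose_mul, (posDef_inputWeight hY).transpose_eq] at h
      simpa [dual, dualController, innovationCov, inputWeight, hY.transpose_eq,
        Matrix.mul_assoc] using h)
  refine ⟨P, Y, H, Γ, _, hP, hY, hPR hHΓ, controlRiccati_iff_dual.2 (hYR ?_), hΓH, hX, hBK, ?_, hE⟩
  · rw [Matrix.neg_mul, Matrix.mul_neg, neg_neg, ← transpose_mul, hHΓ, transpose_one]
  · rw [kalmanGain_dual hY.transpose_eq] at hCK
    have h := congrArg transpose hCK
    simpa [dualController, Controller.BK, Controller.CK] using h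

/-- A controller with the estimator gain form attains the lower bound of `le_cost`. -/
theorem cost_eq_of_gain {n m p q : ℕ} {S : LQGSystem n m p} {K : Controller m p q}
    {Ω : Type*} [MeasurableSpace Ω] {μ : Measure Ω} [IsProbabilityMeasure μ]
    {N : S.RandomInputs q μ} {P Y : Matrix (Fin n) (Fin n) ℝ} (hY : Y.PosSemidef)
    (hYR : S.ControlRiccati Y) (hK : K ∈ S.stabilizing q) {H : Matrix (Fin n) (Fin q) ℝ}
    {X₂ : Matrix (Fin q) (Fin q) ℝ}
    (hX : schurBlocks P H X₂ = S.closedLoop K * schurBlocks P H X₂ * (S.closedLoop K)ᵀ +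
      S.closedLoopNoise K)
    (hC : K.CK = -(S.feedbackGain Y * H)) :
    S.cost N K = (Y * S.W).trace +
      (S.inputWeight Y * (S.feedbackGain Y * P * (S.feedbackGain Y)ᵀ)).trace := by
  -- The difference factors through [H; 1], and [K, C_K] [H; 1] = K H + C_K = 0.
  have h : fromCols (S.feedbackGain Y) K.CK * (schurBlocks P H X₂ - fromBlocks P 0 0 0) = 0 := by
    have h1 : schurBlocks P H X₂ - fromBlocks P 0 0 0 =
        fromBlocks (H * X₂ * Hᵀ) (H * X₂) (X₂ * Hᵀ) X₂ := by
      rw [sub_eq_iff_eq_add, fromBlocks_add, schurBlocks]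
      simp [add_comm]
    rw [h1, hC, fromCols_mul_fromBlocks]
    simp [Matrix.mul_assoc]
  rw [cost_eq_of_riccati (P := P) hY hYR hK hX, h]
  simp

end LQGSystem

/-- Under the minimality assumption, the limit defining the LQG cost exists on the set of
full-order stabilizing controllers, both Riccati equations have a unique positive semidefinite
solution, which is positive definite, and every minimal stationary point of the LQG cost is a global
minimizer over the full-order stabilizing controllers and has the stated form. -/
theorem mainTheorem12 {n m p : ℕ} (S : LQGSystem n m p) (hS : S.MinimalityAssumption)
    {Ω : Type*} [MeasurableSpace Ω] (μ : Measure Ω) [IsProbabilityMeasure μ]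
    (N : S.RandomInputs n μ) :
    (∀ K ∈ S.stabilizing n, (∀ t, Integrable (S.stageCost N K t) μ) ∧
      Tendsto (S.averageCost N K) atTop (𝓝 (S.cost N K))) ∧
    ∃ P Y : Matrix (Fin n) (Fin n) ℝ,
      (P.PosDef ∧ S.FilterRiccati P ∧ ∀ P', P'.PosSemidef → S.FilterRiccati P' → P' = P) ∧
      (Y.PosDef ∧ S.ControlRiccati Y ∧ ∀ Y', Y'.PosSemidef → S.ControlRiccati Y' → Y' = Y) ∧
      ∀ K : Controller m p n, S.IsStationary N K → K.IsMinimal →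
        IsMinOn (S.cost N) (S.stabilizing n) K ∧
        ∃ T : Matrix (Fin n) (Fin n) ℝ, IsUnit T ∧
          K.AK = T * (S.A - S.B * S.feedbackGain Y - S.kalmanGain P * S.C) * T⁻¹ ∧
          K.BK = -(T * S.kalmanGain P) ∧
          K.CK = S.feedbackGain Y * T⁻¹ := by
  refine ⟨fun K hK => ⟨fun t => LQGSystem.integrable_stageCost N K t, S.tendsto_averageCost_cost N hK⟩, ?_⟩
  obtain ⟨P, hP, hPR, hPu⟩ := S.exists_posDef_filterRiccati hS.observable_C hS.controllable_W
  obtain ⟨Y, hY, hYR, hYu⟩ := S.exists_posDef_controlRiccati hS.controllable_B hS.observable_Q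
  refine ⟨P, Y, ⟨hP, hPR, hPu⟩, ⟨hY, hYR, hYu⟩, fun K hK hmin => ?_⟩
  obtain ⟨P', Y', H, Γ, X₂, hP', hY', hPR', hYR', hΓH, hX, hB, hC, hE⟩ :=
    hK.exists_gain_form hmin
  obtain rfl := hPu P' hP' hPR'
  obtain rfl := hYu Y' hY' hYR'
  have hHΓ : H * Γ = 1 := mul_eq_one_comm.1 hΓH
  -- The similarity is T = -Γ, since B_K = Γ L has to equal -T L.
  have hinv : (-Γ)⁻¹ = -H := inv_eq_right_inv (by rw [Matrix.neg_mul, Matrix.mul_neg, neg_neg, hΓH])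
  refine ⟨fun K' hK' => ?_, -Γ, (IsUnit.of_mul_eq_one H hΓH).neg, ?_, ?_, ?_⟩
  · rw [Set.mem_ofPred_eq, LQGSystem.cost_eq_of_gain hY' hYR' hK.1 hX hC]
    exact LQGSystem.le_cost hP' hPR' hY' hYR' hK'
  · rw [hinv, eq_sub_of_add_eq' hE, hC, hB]
    simp only [Matrix.mul_sub, Matrix.sub_mul, Matrix.mul_add, Matrix.mul_neg, Matrix.neg_mul,
      Matrix.mul_assoc]
    abel
  · rw [hB, Matrix.neg_mul, neg_neg]
  · rw [hinv, hC, Matrix.mul_neg]
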